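/- Let $G=(V,E)$ be a weighted undirected graph on $n=|V|$ vertices without self-loops, with real edge weights that may be negative. Let $A$ be its (symmetric, zero-diagonal) adjacency matrix, let $d_i=\sum_j |A_{i,j}|$ be the weighted degrees and $D=\mathrm{diag}(d_1,\dots,d_n)$. For disjoint $L,R\subseteq V$ with $S=L\cup R$ and $\mathrm{vol}(S)=\sum_{i\in S}d_i>0$, let $y\in\{-1,0,1\}^V$ be $-1$ on $L$, $1$ on $R$ and $0$ outside $S$, and call $$-\frac{y^TAy}{y^TDy}$$ the gain of the partition $(L,R)$ of $S$; it is twice the difference between the total weight of the cut edges and the total weight of the uncut edges among the edges induced by $S$, divided by $\mathrm{vol}(S)$. The gain ratio of a graph with at least one edge is $$\gamma(G)=\max_{y\in\{-1,0,1\}^V,\ y^TDy\neq 0}-\frac{y^TAy}{y^TDy},$$ and $\gamma(G)=0$ for a graph without edges. Theorem. There is a nearly quadratic time deterministic algorithm which, given a graph $G$ with $\gamma(G)\ge\varepsilon>0$ (the number $\varepsilon$ is not part of the input), finds a set $S$ and a partition $(L,R)$ of $S$ whose gain is at least $e^{-O(1/\varepsilon)}$. Precisely: there are a program for the real RAM (unit-cost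 exact arithmetic $+,-,\times,\div$ and comparisons on reals, unit-cost addition, subtraction and comparison of indices, indirect addressing, integral constants) and absolute constants $c,C>0$, $k\in\mathbb N$ such that, for every $\varepsilon>0$ and every weighted graph $G$ with $\gamma(G)\ge\varepsilon$ given by a list of its edges, the program halts after at most $C\cdot|V|\,(|V|+|E|)\,(\log|V|)^k$ steps and outputs disjoint sets $L,R\subseteq V$ such that $S=L\cup R$ has positive volume and the gain of $(L,R)$ is at least $e^{-c/\varepsilon}$. -/

import Mathlib

open scoped Matrix

/-! ## Gain and gain ratio of a weighted graph

A weighted graph without self-loops on the vertex set `Fin n`, possibly with negative weights, is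
given by its adjacency matrix: a real symmetric matrix `A` with zero diagonal. -/

/-- The weighted degree `d_i = ∑_j |A i j|`. -/
noncomputable def wdeg {n : ℕ} (A : Matrix (Fin n) (Fin n) ℝ) (i : Fin n) : ℝ :=
  ∑ j, |A i j|

/-- The diagonal matrix `D` of weighted degrees. -/
noncomputable def degMatrix {n : ℕ} (A : Matrix (Fin n) (Fin n) ℝ) :
    Matrix (Fin n) (Fin n) ℝ :=
  Matrix.diagonal (wdeg A)

/-- The quotient `- (yᵀ A y) / (yᵀ D y)`. -/
noncomputable def gainQuotient {n : ℕ} (A : Matrix (Fin n) (Fin n) ℝ) (y : Fin n → ℝ) : ℝ :=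
  -(y ⬝ᵥ (A *ᵥ y)) / (y ⬝ᵥ (degMatrix A *ᵥ y))

/-- The gain ratio `γ(G)`, the maximum over `y ∈ {-1,0,1}^V` of `- (yᵀ A y) / (yᵀ D y)`.
The supremum is over a finite nonempty type, hence a maximum.  A vector with `yᵀ D y = 0`
contributes `0`; this is harmless, since every edge `{i,j}` gives a vector supported on `i, j` with a
positive quotient.  A graph without edges has gain ratio `0`. -/
noncomputable def gainRatio {n : ℕ} (A : Matrix (Fin n) (Fin n) ℝ) : ℝ :=
  ⨆ y : Fin n → SignType, gainQuotient A (fun i => (y i : ℝ))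

/-- The vector of a pair `(L, R)` of disjoint sets: `-1` on `L`, `1` on `R`, `0` elsewhere. -/
def cutVec {n : ℕ} (L R : Finset (Fin n)) (i : Fin n) : ℝ :=
  if i ∈ L then -1 else if i ∈ R then 1 else 0

/-- The volume of a set of vertices. -/
noncomputable def volumeOf {n : ℕ} (A : Matrix (Fin n) (Fin n) ℝ) (S : Finset (Fin n)) : ℝ :=
  ∑ i ∈ S, wdeg A i

/-- The gain of a partition `(L, R)` of the set `S = L ∪ R`: twice the difference between the weight of
the cut edges and that of the uncut edges among those induced by `S`, divided by the volume of `S`. -/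
noncomputable def gain {n : ℕ} (A : Matrix (Fin n) (Fin n) ℝ) (L R : Finset (Fin n)) : ℝ :=
  gainQuotient A (cutVec L R)

/-- `es` lists every edge of the weighted graph exactly once, as (endpoint, endpoint, weight), in an
arbitrary order and with an arbitrary order of the two endpoints. -/
def IsEdgeList {n : ℕ} (A : Matrix (Fin n) (Fin n) ℝ) (es : List (Fin n × Fin n × ℝ)) : Prop :=
  (es.map (fun e => s(e.1, e.2.1))).Nodup ∧
  (∀ e ∈ es, e.2.2 = A e.1 e.2.1 ∧ e.2.2 ≠ 0) ∧
  (∀ i j, A i j ≠ 0 → ∃ e ∈ es, s(e.1, e.2.1) = s(i, j))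

/-! ## Real RAM programs with a step count

A deterministic random access machine with natural-number cells (used for indices and labels) and
real cells, at unit cost per operation.  On natural numbers there are addition and truncated
subtraction; on reals there are the four exact field operations (with `x / 0 = 0`).  Programs contain
only integral constants; there is no rounding and no conversion from reals to natural numbers. -/

namespace RealRAM

/-- Memory: array number, then index in the array (a register is an array used at one index). -/
structure State where
  nat : ℕ → ℕ → ℕ
  real : ℕ → ℕ → ℝ

/-- Expressions for natural numbers; `load a i` reads the array `a` at the computed index `i`. -/
inductive NExpr where
  | const (c : ℕ)
  | load (a : ℕ) (i : NExpr)
  | add (x y : NExpr)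
  | sub (x y : NExpr)

/-- Expressions for real numbers. -/
inductive RExpr where
  | const (c : ℤ)
  | load (a : ℕ) (i : NExpr)
  | add (x y : RExpr)
  | sub (x y : RExpr)
  | mul (x y : RExpr)
  | div (x y : RExpr)

/-- Tests. -/
inductive Test where
  | natEq (x y : NExpr)
  | natLt (x y : NExpr)
  | realLe (x y : RExpr)
  | realLt (x y : RExpr)

def NExpr.eval (s : State) : NExpr → ℕ
  | .const c => c
  | .load a i => s.nat a (i.eval s)
  | .add x y => x.eval s + y.eval s
  | .sub x y => x.eval s - y.eval s

/-- The number of constants, memory accesses and operations. -/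
def NExpr.cost : NExpr → ℕ
  | .const _ => 1
  | .load _ i => i.cost + 1
  | .add x y => x.cost + y.cost + 1
  | .sub x y => x.cost + y.cost + 1

noncomputable def RExpr.eval (s : State) : RExpr → ℝ
  | .const c => (c : ℝ)
  | .load a i => s.real a (i.eval s)
  | .add x y => x.eval s + y.eval s
  | .sub x y => x.eval s - y.eval s
  | .mul x y => x.eval s * y.eval s
  | .div x y => x.eval s / y.eval s

/-- The number of constants, memory accesses and operations. -/
def RExpr.cost : RExpr → ℕ
  | .const _ => 1
  | .load _ i => i.cost + 1
  | .add x y => x.cost + y.cost + 1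
  | .sub x y => x.cost + y.cost + 1
  | .mul x y => x.cost + y.cost + 1
  | .div x y => x.cost + y.cost + 1

def Test.holds (s : State) : Test → Prop
  | .natEq x y => x.eval s = y.eval s
  | .natLt x y => x.eval s < y.eval s
  | .realLe x y => x.eval s ≤ y.eval s
  | .realLt x y => x.eval s < y.eval s

def Test.cost : Test → ℕ
  | .natEq x y => x.cost + y.cost + 1
  | .natLt x y => x.cost + y.cost + 1
  | .realLe x y => x.cost + y.cost + 1
  | .realLt x y => x.cost + y.cost + 1

/-- Programs: writes to memory, sequencing, branching, and while-loops. -/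
inductive Prog where
  | skip
  | setNat (a : ℕ) (i x : NExpr)
  | setReal (a : ℕ) (i : NExpr) (x : RExpr)
  | seq (p q : Prog)
  | branch (b : Test) (p q : Prog)
  | loop (b : Test) (p : Prog)

def State.writeNat (s : State) (a i v : ℕ) : State :=
  { s with nat := Function.update s.nat a (Function.update (s.nat a) i v) }

def State.writeReal (s : State) (a i : ℕ) (v : ℝ) : State :=
  { s with real := Function.update s.real a (Function.update (s.real a) i v) }

/-- `Exec p s s' t`: started in the state `s`, the program `p` halts in the state `s'` after exactly
`t` steps. -/
inductive Exec : Prog → State → State → ℕ → Prop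
  | skip (s : State) : Exec .skip s s 1
  | setNat (s : State) (a : ℕ) (i x : NExpr) :
      Exec (.setNat a i x) s (s.writeNat a (i.eval s) (x.eval s)) (i.cost + x.cost + 1)
  | setReal (s : State) (a : ℕ) (i : NExpr) (x : RExpr) :
      Exec (.setReal a i x) s (s.writeReal a (i.eval s) (x.eval s)) (i.cost + x.cost + 1)
  | seq {p q : Prog} {s s₁ s₂ : State} {t₁ t₂ : ℕ} :
      Exec p s s₁ t₁ → Exec q s₁ s₂ t₂ → Exec (.seq p q) s s₂ (t₁ + t₂)
  | branchTrue {b : Test} {p q : Prog} {s s₁ : State} {t : ℕ} :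
      b.holds s → Exec p s s₁ t → Exec (.branch b p q) s s₁ (b.cost + t)
  | branchFalse {b : Test} {p q : Prog} {s s₁ : State} {t : ℕ} :
      ¬ b.holds s → Exec q s s₁ t → Exec (.branch b p q) s s₁ (b.cost + t)
  | loopDone {b : Test} {p : Prog} {s : State} :
      ¬ b.holds s → Exec (.loop b p) s s b.cost
  | loopStep {b : Test} {p : Prog} {s s₁ s₂ : State} {t₁ t₂ : ℕ} :
      b.holds s → Exec p s s₁ t₁ → Exec (.loop b p) s₁ s₂ t₂ →
      Exec (.loop b p) s s₂ (b.cost + t₁ + t₂)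

/-- The machine is deterministic: the final state and the number of steps are determined by the
program and the initial state. -/
theorem Exec.deterministic {p : Prog} {s s₁ s₂ : State} {t₁ t₂ : ℕ}
    (h₁ : Exec p s s₁ t₁) (h₂ : Exec p s s₂ t₂) : s₁ = s₂ ∧ t₁ = t₂ := by
  induction h₁ generalizing s₂ t₂ with
  | skip => cases h₂; exact ⟨rfl, rfl⟩
  | setNat => cases h₂; exact ⟨rfl, rfl⟩
  | setReal => cases h₂; exact ⟨rfl, rfl⟩
  | seq _ _ ih ih' =>
    cases h₂ with
    | seq h h' =>
      obtain ⟨rfl, rfl⟩ := ih h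
      obtain ⟨rfl, rfl⟩ := ih' h'
      exact ⟨rfl, rfl⟩
  | branchTrue hb _ ih =>
    cases h₂ with
    | branchTrue _ h => obtain ⟨rfl, rfl⟩ := ih h; exact ⟨rfl, rfl⟩
    | branchFalse hb' _ => exact absurd hb hb'
  | branchFalse hb _ ih =>
    cases h₂ with
    | branchTrue hb' _ => exact absurd hb' hb
    | branchFalse _ h => obtain ⟨rfl, rfl⟩ := ih h; exact ⟨rfl, rfl⟩
  | loopDone hb =>
    cases h₂ with
    | loopDone => exact ⟨rfl, rfl⟩
    | loopStep hb' => exact absurd hb' hb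
  | loopStep hb _ _ ih ih' =>
    cases h₂ with
    | loopDone hb' => exact absurd hb hb'
    | loopStep _ h h' =>
      obtain ⟨rfl, rfl⟩ := ih h
      obtain ⟨rfl, rfl⟩ := ih' h'
      exact ⟨rfl, rfl⟩

/-- The input: natural-number array `0` holds the number of vertices and the number of edges, the
arrays `1` and `2` hold the two endpoints of each edge, and real array `0` holds the weights.
All other cells are zero. -/
def inputState (n : ℕ) (es : List (Fin n × Fin n × ℝ)) : State where
  nat a i :=
    if a = 0 then (if i = 0 then n else if i = 1 then es.length else 0)
    else if a = 1 then (es[i]?).elim 0 (fun e => (e.1 : ℕ))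
    else if a = 2 then (es[i]?).elim 0 (fun e => (e.2.1 : ℕ))
    else 0
  real a i := if a = 0 then (es[i]?).elim 0 (fun e => e.2.2) else 0

/-- The output: natural-number array `3` holds the label of each vertex, which is `1` on `L`, `2` on
`R`, and `0` on the vertices outside of `S = L ∪ R`. -/
def Outputs {n : ℕ} (s : State) (L R : Finset (Fin n)) : Prop :=
  ∀ i : Fin n, s.nat 3 (i : ℕ) = if i ∈ L then 1 else if i ∈ R then 2 else 0

end RealRAM

/-!
# Partitions of large gain in nearly quadratic time

Let `M = 1 - D⁻¹ A`, a nonnegative self-adjoint operator for the inner product `xᵀ D y`.  If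
`γ(G) ≥ ε`, then `M` has Rayleigh quotient at least `1 + ε` at some sign vector.  The algorithm has
four stages.

*Power method.*  The moments `xᵀ D Mʲ x` form a log-convex sequence (`moment_logConvex`), so that
their consecutive ratios increase.  Expand the sign vector in the standard basis: if no start vector
`e_v` reached the ratio `1 + ε / 2` within `k` steps, then `(1 + ε) ^ (2k) ≤ n (1 + ε / 2) ^ (2k)`, which is
false as soon as `k` exceeds a multiple of `log n / ε` (`exists_gainQuotient_powerStep_ge`).  Hence
`2 K²` steps with `K = ⌈log₂ n⌉`, from each of the `n` vertices, give an `x` of quotient at least `ε / 2`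
whenever `ε ≥ 1 / K`.

*Window.*  Group the entries of `x` by their binary order of magnitude, and cut the orders into blocks
of `L ≈ 8 / ε` consecutive ones with a random offset.  An edge whose ends differ by `k` orders is cut
with probability at most `k / L`, while the product of its ends is at most `1 / k` times the larger
square; so only an `ε / 4` fraction of `xᵀ D x` is lost, and some block keeps the quotient `ε / 4`
(`exists_dyadic_window`).  The entries of a block are within a factor `2 ^ L` of each other.  For the
scaled vector `z` with `2 ^ (-L) ≤ |z_i| ≤ 1` on the block, the quotient with `∑ d_i |z_i|` in place of
`∑ d_i z_i²` is then at least `(ε / 4) 2 ^ (-L) = e ^ (-O(1/ε))` (`exists_window`).  It is enough to try blocks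
that begin or end at an entry of `x` (`exists_window_at_entry`).  Since `L` depends on the unknown `ε`,
all `L ≤ 9 K` are tried and the best `z` is kept.

*Small `ε`.*  If `ε < 1 / K`, then `e ^ (-O(1/ε))` is below `1 / n`, and the heaviest edge alone has
quotient at least `1 / n` (`one_div_le_roundingQuotient_edgeVec`).  It is the first candidate for `z`.

*Rounding.*  Let `θ` be half of the quotient of `z`.  As `A` has zero diagonal, the function
`- zᵀ A z - θ ∑ d_i |z_i|` is affine in `z_i` on `[-1, 0]` and on `[0, 1]`, so every coordinate can be moved to
`-1`, `0` or `1` without decreasing it.  The result `y` is nonzero and has gain at least `θ`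
(`half_le_gainQuotient_of_lagrangian_le`).

The program is verified with a small logic of total correctness with time bounds (`RealRAM.Runs`),
in which arrays to which a program does not assign are known to be unchanged (`RealRAM.Prog.Frame`).
-/

/-! ### Log-convex sequences and the power method -/

theorem le_pow_mul_of_logConvex {a : ℕ → ℝ} {q : ℝ} (hq : 0 < q)
    (hlc : ∀ j, a (j + 1) ^ 2 ≤ a j * a (j + 2)) (h0 : 0 < a 0) (h1 : q * a 0 ≤ a 1) (N : ℕ) :
    q ^ N * a 0 ≤ a N := by
  have key : ∀ j, q ^ j * a 0 ≤ a j ∧ q * a j ≤ a (j + 1) := by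
    intro j
    induction j with
    | zero => simpa using h1
    | succ j ih =>
      have hj : 0 < a j := lt_of_lt_of_le (by positivity) ih.1
      have hj1 : 0 < a (j + 1) := lt_of_lt_of_le (by positivity) ih.2
      refine ⟨?_, ?_⟩
      · calc q ^ (j + 1) * a 0 = q * (q ^ j * a 0) := by ring
          _ ≤ q * a j := by gcongr; exact ih.1
          _ ≤ _ := ih.2
      · refine le_of_mul_le_mul_left ?_ hj
        calc a j * (q * a (j + 1)) = q * a j * a (j + 1) := by ring
          _ ≤ a (j + 1) * a (j + 1) := by gcongr; exact ih.2
          _ ≤ a j * a (j + 1 + 1) := by rw [← sq]; exact hlc j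
  exact (key N).1

theorem le_pow_mul_of_logConvex_of_last {a : ℕ → ℝ} {q : ℝ} (hq : 0 ≤ q) (ha : ∀ j, 0 ≤ a j)
    (hlc : ∀ j, a (j + 1) ^ 2 ≤ a j * a (j + 2)) (N : ℕ) (h : a (N + 1) ≤ q * a N) :
    a N ≤ q ^ N * a 0 := by
  induction N with
  | zero => simp
  | succ N ih =>
    have h' : a (N + 1) ≤ q * a N := by
      rcases (ha (N + 1)).eq_or_lt with h0 | h0
      · rw [← h0]; exact mul_nonneg hq (ha N)
      · refine le_of_mul_le_mul_right ?_ h0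
        calc a (N + 1) * a (N + 1) ≤ a N * a (N + 2) := by rw [← sq]; exact hlc N
          _ ≤ a N * (q * a (N + 1)) := by exact mul_le_mul_of_nonneg_left h (ha N)
          _ = _ := by ring
    calc a (N + 1) ≤ q * a N := h'
      _ ≤ q * (q ^ N * a 0) := by gcongr; exact ih h'
      _ = _ := by ring

section WeightedGraph

variable {n : ℕ} {A : Matrix (Fin n) (Fin n) ℝ}

theorem wdeg_nonneg (i : Fin n) : 0 ≤ wdeg A i := Finset.sum_nonneg fun _ _ => abs_nonneg _

theorem abs_le_wdeg (i j : Fin n) : |A i j| ≤ wdeg A i :=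
  Finset.single_le_sum (f := fun l => |A i l|) (fun _ _ => abs_nonneg _) (Finset.mem_univ j)

theorem mulVec_eq_zero_of_wdeg_eq_zero {i : Fin n} (h : wdeg A i = 0) (x : Fin n → ℝ) :
    (A *ᵥ x) i = 0 := by
  refine Finset.sum_eq_zero (s := Finset.univ) (f := fun j => A i j * x j) fun j _ => ?_
  have := abs_le_wdeg (A := A) i j
  rw [h] at this
  rw [abs_nonpos_iff.mp this, zero_mul]

theorem dotProduct_degMatrix (x y : Fin n → ℝ) :
    x ⬝ᵥ (degMatrix A *ᵥ y) = ∑ i, wdeg A i * (x i * y i) := by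
  simp only [degMatrix, dotProduct, Matrix.mulVec_diagonal]
  exact Finset.sum_congr rfl fun i _ => by ring

theorem degMatrix_form_nonneg (x : Fin n → ℝ) : 0 ≤ x ⬝ᵥ (degMatrix A *ᵥ x) := by
  rw [dotProduct_degMatrix]
  exact Finset.sum_nonneg fun i _ => mul_nonneg (wdeg_nonneg i) (mul_self_nonneg _)

theorem dotProduct_mulVec_eq_sum (x y : Fin n → ℝ) :
    x ⬝ᵥ (A *ᵥ y) = ∑ i, ∑ j, A i j * (x i * y j) := by
  simp only [dotProduct, Matrix.mulVec, Finset.mul_sum]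
  exact Finset.sum_congr rfl fun i _ => Finset.sum_congr rfl fun j _ => by ring

theorem sum_sum_abs_mul_left (g : Fin n → ℝ) : ∑ i, ∑ j, |A i j| * g i = ∑ i, wdeg A i * g i := by
  simp [wdeg, Finset.sum_mul]

theorem sum_sum_abs_mul_right (hA : A.IsSymm) (g : Fin n → ℝ) :
    ∑ i, ∑ j, |A i j| * g j = ∑ i, wdeg A i * g i := by
  rw [Finset.sum_comm, ← sum_sum_abs_mul_left]
  exact Finset.sum_congr rfl fun i _ => Finset.sum_congr rfl fun j _ => by rw [hA.apply]

/-- All eigenvalues of `D⁻¹ A` lie between `-1` and `1`. -/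
theorem abs_form_le (hA : A.IsSymm) (x : Fin n → ℝ) :
    |x ⬝ᵥ (A *ᵥ x)| ≤ x ⬝ᵥ (degMatrix A *ᵥ x) := by
  have h : ∑ i, ∑ j, |A i j| * ((x i * x i + x j * x j) / 2) = x ⬝ᵥ (degMatrix A *ᵥ x) := by
    rw [dotProduct_degMatrix]
    have h1 := sum_sum_abs_mul_left (A := A) (fun i => x i * x i)
    have h2 := sum_sum_abs_mul_right hA (fun i => x i * x i)
    calc _ = (∑ i, ∑ j, |A i j| * (x i * x i) + ∑ i, ∑ j, |A i j| * (x j * x j)) / 2 := by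
          simp only [← Finset.sum_add_distrib, Finset.sum_div]
          exact Finset.sum_congr rfl fun i _ => Finset.sum_congr rfl fun j _ => by ring
      _ = _ := by rw [h1, h2]; ring
  rw [← h, dotProduct_mulVec_eq_sum]
  refine (Finset.abs_sum_le_sum_abs _ _).trans (Finset.sum_le_sum fun i _ => ?_)
  refine (Finset.abs_sum_le_sum_abs _ _).trans (Finset.sum_le_sum fun j _ => ?_)
  rw [abs_mul, abs_mul]
  gcongr
  nlinarith [sq_nonneg (|x i| - |x j|), abs_mul_abs_self (x i), abs_mul_abs_self (x j)]

theorem neg_form_le (hA : A.IsSymm) (x : Fin n → ℝ) :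
    -(x ⬝ᵥ (A *ᵥ x)) ≤ x ⬝ᵥ (degMatrix A *ᵥ x) :=
  (neg_le_abs _).trans (abs_form_le hA x)

theorem gainQuotient_le_one (hA : A.IsSymm) (x : Fin n → ℝ) : gainQuotient A x ≤ 1 :=
  div_le_one_of_le₀ (neg_form_le hA x) (degMatrix_form_nonneg x)

theorem neg_form_eq_zero_of_degMatrix_form_eq_zero (hA : A.IsSymm) {x : Fin n → ℝ}
    (h : x ⬝ᵥ (degMatrix A *ᵥ x) = 0) : x ⬝ᵥ (A *ᵥ x) = 0 :=
  abs_nonpos_iff.mp (h ▸ abs_form_le hA x)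

variable (A) in
/-- One step of the power method: multiplication by `1 - D⁻¹ A`.  An isolated vertex keeps its
value, because of `0 / 0 = 0`. -/
noncomputable def powerStep : (Fin n → ℝ) →ₗ[ℝ] (Fin n → ℝ) where
  toFun x i := x i - (A *ᵥ x) i / wdeg A i
  map_add' x y := by ext i; simp [Matrix.mulVec_add]; ring
  map_smul' r x := by ext i; simp [Matrix.mulVec_smul]; ring

variable (A) in
/-- The bilinear form `xᵀ D y`. -/
noncomputable def degForm : LinearMap.BilinForm ℝ (Fin n → ℝ) := Matrix.toBilin' (degMatrix A)

variable (A) in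
/-- The bilinear form `xᵀ (D - A) y`, which is `xᵀ D M y` for the operator `M = 1 - D⁻¹ A`. -/
noncomputable def diffForm : LinearMap.BilinForm ℝ (Fin n → ℝ) :=
  Matrix.toBilin' (degMatrix A - A)

theorem degForm_apply (x y : Fin n → ℝ) : degForm A x y = x ⬝ᵥ (degMatrix A *ᵥ y) :=
  Matrix.toBilin'_apply' _ _ _

theorem diffForm_apply (x y : Fin n → ℝ) :
    diffForm A x y = x ⬝ᵥ (degMatrix A *ᵥ y) - x ⬝ᵥ (A *ᵥ y) := by
  rw [diffForm, Matrix.toBilin'_apply', Matrix.sub_mulVec, dotProduct_sub]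

theorem degForm_comm (x y : Fin n → ℝ) : degForm A x y = degForm A y x := by
  simp only [degForm_apply, dotProduct_degMatrix, mul_comm (x _)]

theorem diffForm_comm (hA : A.IsSymm) (x y : Fin n → ℝ) : diffForm A x y = diffForm A y x := by
  rw [diffForm_apply, diffForm_apply, ← degForm_apply, degForm_comm, degForm_apply,
    Matrix.dotProduct_mulVec x, ← Matrix.mulVec_transpose, hA.eq, dotProduct_comm y (A *ᵥ x),
    dotProduct_comm y]

theorem degForm_nonneg (x : Fin n → ℝ) : 0 ≤ degForm A x x := by
  rw [degForm_apply]; exact degMatrix_form_nonneg x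

theorem diffForm_nonneg (hA : A.IsSymm) (x : Fin n → ℝ) : 0 ≤ diffForm A x x := by
  rw [diffForm_apply]
  linarith [abs_form_le hA x, le_abs_self (x ⬝ᵥ (A *ᵥ x))]

theorem degForm_powerStep (x y : Fin n → ℝ) : degForm A x (powerStep A y) = diffForm A x y := by
  rw [degForm_apply, diffForm_apply, dotProduct_degMatrix, dotProduct_degMatrix, dotProduct,
    ← Finset.sum_sub_distrib]
  refine Finset.sum_congr rfl fun i _ => ?_
  simp only [powerStep, LinearMap.coe_mk, AddHom.coe_mk]
  by_cases h : wdeg A i = 0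
  · simp [h, mulVec_eq_zero_of_wdeg_eq_zero h]
  · field_simp

theorem degForm_powerStep_comm (hA : A.IsSymm) (x y : Fin n → ℝ) :
    degForm A (powerStep A x) y = degForm A x (powerStep A y) := by
  rw [degForm_comm, degForm_powerStep, degForm_powerStep, diffForm_comm hA]

theorem degForm_powerStep_pow (hA : A.IsSymm) (x y : Fin n → ℝ) (i j : ℕ) :
    degForm A ((powerStep A ^ i) x) ((powerStep A ^ j) y) = degForm A x ((powerStep A ^ (i + j)) y) := by
  induction i generalizing j with
  | zero => simp
  | succ i ih =>
    rw [pow_succ', Module.End.mul_apply, degForm_powerStep_comm hA, ← Module.End.mul_apply,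
      ← pow_succ', ih, show i + (j + 1) = i + 1 + j by ring]

variable (A) in
/-- The moments `xᵀ D Mʲ x` of the operator `M = 1 - D⁻¹ A`. -/
noncomputable def moment (x : Fin n → ℝ) (j : ℕ) : ℝ := degForm A x ((powerStep A ^ j) x)

theorem moment_even (hA : A.IsSymm) (x : Fin n → ℝ) (j : ℕ) :
    moment A x (2 * j) = degForm A ((powerStep A ^ j) x) ((powerStep A ^ j) x) := by
  rw [degForm_powerStep_pow hA, moment, two_mul]

theorem moment_odd (hA : A.IsSymm) (x : Fin n → ℝ) (j : ℕ) :
    moment A x (2 * j + 1) = diffForm A ((powerStep A ^ j) x) ((powerStep A ^ j) x) := by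
  rw [← degForm_powerStep, ← Module.End.mul_apply, ← pow_succ', degForm_powerStep_pow hA, moment,
    show j + (j + 1) = 2 * j + 1 by ring]

theorem moment_nonneg (hA : A.IsSymm) (x : Fin n → ℝ) (j : ℕ) : 0 ≤ moment A x j := by
  rcases Nat.even_or_odd' j with ⟨i, rfl | rfl⟩
  · rw [moment_even hA]; exact degForm_nonneg _
  · rw [moment_odd hA]; exact diffForm_nonneg hA _

/-- The Cauchy–Schwarz inequality for the form `xᵀ D y` (odd indices) or `xᵀ (D - A) y` (even
indices). -/
theorem moment_logConvex (hA : A.IsSymm) (x : Fin n → ℝ) (j : ℕ) :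
    moment A x (j + 1) ^ 2 ≤ moment A x j * moment A x (j + 2) := by
  rcases Nat.even_or_odd' j with ⟨i, rfl | rfl⟩
  · have h := (degForm A).apply_sq_le_of_symm degForm_nonneg ⟨fun x y => degForm_comm x y⟩
      ((powerStep A ^ i) x) ((powerStep A ^ (i + 1)) x)
    rw [degForm_powerStep_pow hA, ← moment_even hA, ← moment_even hA,
      show i + (i + 1) = 2 * i + 1 by ring, show 2 * (i + 1) = 2 * i + 2 by ring] at h
    exact h
  · have h := (diffForm A).apply_sq_le_of_symm (diffForm_nonneg hA)
      ⟨fun x y => diffForm_comm hA x y⟩ ((powerStep A ^ i) x) ((powerStep A ^ (i + 1)) x)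
    rw [← degForm_powerStep, ← Module.End.mul_apply, ← pow_succ', degForm_powerStep_pow hA,
      ← moment_odd hA, ← moment_odd hA, show i + (i + 1 + 1) = 2 * i + 1 + 1 by ring,
      show 2 * (i + 1) + 1 = 2 * i + 1 + 2 by ring] at h
    exact h

/-- If no vertex is a good starting point of the power method, then neither is any vector. -/
theorem exists_gainQuotient_powerStep_ge (hA : A.IsSymm) {ε : ℝ} (hε : 0 < ε) {k : ℕ}
    (hk : (n : ℝ) < (1 + ε / 3) ^ (2 * k)) {y : Fin n → ℝ} (hy : ε ≤ gainQuotient A y) :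
    ∃ v, ε / 2 ≤ gainQuotient A ((powerStep A ^ k) (Pi.single v 1)) := by
  by_contra! hcon
  have hε1 : ε ≤ 1 := hy.trans (gainQuotient_le_one hA y)
  set a := moment A y with ha
  have ha0 : a 0 = y ⬝ᵥ (degMatrix A *ᵥ y) := by simp [ha, moment, degForm_apply]
  have hpos : 0 < a 0 := by
    rw [ha0]
    refine (degMatrix_form_nonneg y).lt_of_ne fun h => ?_
    rw [gainQuotient, ← h, div_zero] at hy
    linarith
  have hstart : (1 + ε) * a 0 ≤ a 1 := by
    have h1 : a 1 = a 0 - y ⬝ᵥ (A *ᵥ y) := by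
      rw [ha0, ← diffForm_apply]; exact moment_odd hA y 0
    rw [gainQuotient, le_div_iff₀ (ha0 ▸ hpos), ← ha0] at hy
    linarith
  have hlow := le_pow_mul_of_logConvex (by positivity) (moment_logConvex hA y) hpos hstart (2 * k)
  have hup : ∀ v, moment A (Pi.single v 1) (2 * k) ≤ (1 + ε / 2) ^ (2 * k) * wdeg A v := by
    intro v
    have h := le_pow_mul_of_logConvex_of_last (q := 1 + ε / 2) (by positivity)
      (moment_nonneg hA (Pi.single v 1)) (moment_logConvex hA _) (2 * k) ?_
    · refine h.trans_eq ?_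
      congr 1
      simp [moment, degForm_apply, degMatrix]
    · rw [moment_even hA, moment_odd hA, diffForm_apply, degForm_apply]
      set x := (powerStep A ^ k) (Pi.single v 1)
      have hv := hcon v
      rcases (degMatrix_form_nonneg (A := A) x).eq_or_lt with h0 | h0
      · rw [neg_form_eq_zero_of_degMatrix_form_eq_zero hA h0.symm, ← h0]; simp
      · rw [gainQuotient, div_lt_iff₀ h0] at hv
        linarith
  have hsum : a (2 * k) ≤ n * ((1 + ε / 2) ^ (2 * k) * a 0) := by
    rw [ha, moment_even hA, degForm_apply, dotProduct_degMatrix]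
    set f : Fin n → Fin n → ℝ := fun v => (powerStep A ^ k) (Pi.single v 1) with hf
    have hexp : (powerStep A ^ k) y = ∑ v, y v • f v := by
      conv_lhs => rw [← Finset.univ_sum_single y, map_sum]
      refine Finset.sum_congr rfl fun v _ => ?_
      rw [hf, ← map_smul]
      congr 1
      ext i
      by_cases h : i = v <;> simp [h]
    calc ∑ i, wdeg A i * ((powerStep A ^ k) y i * (powerStep A ^ k) y i)
        ≤ ∑ i, wdeg A i * (n * ∑ v, (y v * f v i) ^ 2) := by
          refine Finset.sum_le_sum fun i _ => mul_le_mul_of_nonneg_left ?_ (wdeg_nonneg i)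
          rw [hexp, ← sq]
          simp only [Finset.sum_apply, Pi.smul_apply, smul_eq_mul]
          simpa using sq_sum_le_card_mul_sum_sq (s := Finset.univ) (f := fun v => y v * f v i)
      _ = n * ∑ v, y v ^ 2 * moment A (Pi.single v 1) (2 * k) := by
          simp only [moment_even hA, degForm_apply, dotProduct_degMatrix, Finset.mul_sum]
          rw [Finset.sum_comm]
          refine Finset.sum_congr rfl fun v _ => Finset.sum_congr rfl fun i _ => ?_
          simp only [hf]; ring
      _ ≤ n * ∑ v, y v ^ 2 * ((1 + ε / 2) ^ (2 * k) * wdeg A v) := by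
          gcongr with v; exact hup v
      _ = _ := by
          rw [← ha, ha0, dotProduct_degMatrix]
          simp only [Finset.mul_sum]
          exact Finset.sum_congr rfl fun v _ => by ring
  have h1 : (1 + ε) ^ (2 * k) ≤ n * (1 + ε / 2) ^ (2 * k) := by
    refine le_of_mul_le_mul_right (hlow.trans (hsum.trans_eq ?_)) hpos
    ring
  have h2 : ((1 + ε / 3) * (1 + ε / 2)) ^ (2 * k) ≤ (1 + ε) ^ (2 * k) := by
    gcongr; nlinarith
  rw [mul_pow] at h2
  have h3 : (0 : ℝ) < (1 + ε / 2) ^ (2 * k) := by positivity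
  exact absurd (le_of_mul_le_mul_right (h2.trans h1) h3) (not_le.mpr hk)

end WeightedGraph

/-! ### Windows of comparable entries -/

/-- Shifting two integers by the same random amount and rounding down to multiples of `L` separates
them with probability at most their distance divided by `L`. -/
theorem card_filter_ediv_ne_le {L : ℕ} (hL : 0 < L) (b c : ℤ) :
    ((Finset.range L).filter fun a : ℕ => (b + a) / (L : ℤ) ≠ (c + a) / (L : ℤ)).card ≤
      (b - c).natAbs := by
  wlog hbc : b ≤ c generalizing b c
  · have := this c b (by omega)
    simp only [ne_comm (a := (b + _) / _)]
    omega
  have hL' : (0 : ℤ) < L := by exact_mod_cast hL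
  have hcard : ((Finset.Ioc b c).image fun r : ℤ => ((-r) % L).toNat).card ≤ (b - c).natAbs := by
    refine Finset.card_image_le.trans ?_
    rw [Int.card_Ioc]; omega
  refine (Finset.card_le_card fun a ha => ?_).trans hcard
  rw [Finset.mem_filter, Finset.mem_range] at ha
  obtain ⟨haL, hne⟩ := ha
  -- the multiple of `L` that separates `b + a` from `c + a`
  set m : ℤ := (c + a) / (L : ℤ) with hm
  have hlt : (b + a) / (L : ℤ) < m := lt_of_le_of_ne (Int.ediv_le_ediv hL' (by omega)) hne
  have h1 : m * L ≤ c + a := Int.ediv_mul_le _ hL'.ne'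
  have h2 : b + a < m * L := (Int.ediv_lt_iff_lt_mul hL').mp hlt
  refine Finset.mem_image.mpr ⟨m * L - a, Finset.mem_Ioc.mpr ⟨by omega, by omega⟩, ?_⟩
  rw [show -(m * L - a) = (a : ℤ) + L * (-m) by ring, Int.add_mul_emod_self_left,
    Int.emod_eq_of_lt (by omega) (by exact_mod_cast haL)]
  simp

/-- Two numbers whose binary orders of magnitude differ by `k` have a product at most `1 / k` times
the larger of the squares. -/
theorem natAbs_log_sub_log_mul_le {x y : ℝ} (hx : 0 ≤ x) (hy : 0 ≤ y) :
    ((Int.log 2 x - Int.log 2 y).natAbs : ℝ) * (x * y) ≤ x * x + y * y := by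
  wlog hxy : y ≤ x generalizing x y
  · have := this hy hx (le_of_not_ge hxy)
    rw [← Int.natAbs_neg, neg_sub, mul_comm x y]
    linarith
  rcases hy.eq_or_lt with rfl | hy
  · simp [mul_self_nonneg]
  have hx : 0 < x := hy.trans_le hxy
  have hlog : Int.log 2 y ≤ Int.log 2 x := Int.log_mono_right hy hxy
  obtain ⟨k, hk⟩ := Int.le.dest hlog
  have hk' : (Int.log 2 x - Int.log 2 y).natAbs = k := by omega
  rw [hk']
  rcases k with _ | k
  · simp; positivity
  have h1 : ((2 : ℕ) : ℝ) ^ Int.log 2 x ≤ x := Int.zpow_log_le_self one_lt_two hx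
  have h2 : y < ((2 : ℕ) : ℝ) ^ (Int.log 2 y + 1) := Int.lt_zpow_succ_log_self one_lt_two y
  have h3 : 2 ^ k * y ≤ x := by
    refine le_trans ?_ h1
    rw [← hk, Nat.cast_add, Nat.cast_one, show Int.log 2 y + ((k : ℤ) + 1) = k + (Int.log 2 y + 1) by ring,
      zpow_add₀ (by norm_num), zpow_natCast]
    push_cast at h2 ⊢
    gcongr
  have h4 : ((k + 1 : ℕ) : ℝ) ≤ 2 ^ k := by exact_mod_cast Nat.lt_two_pow_self
  calc ((k + 1 : ℕ) : ℝ) * (x * y) ≤ 2 ^ k * (x * y) := by gcongr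
    _ = x * (2 ^ k * y) := by ring
    _ ≤ x * x := by gcongr
    _ ≤ _ := by nlinarith

/-- If the classes of `c` together have a positive total, then so has one of them. -/
theorem exists_class_pos {ι κ : Type*} [Fintype ι] [DecidableEq κ] (c : ι → κ)
    (f : ι → ι → ℝ) (g : ι → ℝ)
    (h : 0 < ∑ i, ∑ j, (if c i = c j then f i j else 0) - ∑ i, g i) :
    ∃ q, 0 < ∑ i, ∑ j, (if c i = q ∧ c j = q then f i j else 0) - ∑ i, if c i = q then g i else 0 := by
  by_contra! hcon
  refine absurd h (not_lt.mpr ?_)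
  have hmem : ∀ i ∈ Finset.univ, c i ∈ Finset.univ.image c := fun i _ =>
    Finset.mem_image_of_mem c (Finset.mem_univ i)
  rw [← Finset.sum_fiberwise_of_maps_to hmem, ← Finset.sum_fiberwise_of_maps_to hmem (f := g),
    ← Finset.sum_sub_distrib]
  refine Finset.sum_nonpos fun q _ => le_trans (le_of_eq ?_) (hcon q)
  rw [Finset.sum_filter, Finset.sum_filter]
  congr 1
  refine Finset.sum_congr rfl fun i _ => ?_
  by_cases hi : c i = q
  · simp [hi, eq_comm]
  · simp [hi]

section WeightedGraph

variable {n : ℕ} {A : Matrix (Fin n) (Fin n) ℝ}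

variable (A) in
/-- The quantity `∑ d_i |z_i|`, which is linear in the rounding probabilities `|z_i|`. -/
noncomputable def absVolume (z : Fin n → ℝ) : ℝ := ∑ i, wdeg A i * |z i|

variable (A) in
/-- The quotient `- (zᵀ A z) / ∑ d_i |z_i|`.  A vector `z` with entries in `[-1, 1]` can be rounded to
one with entries in `{-1, 0, 1}` without loss in this quotient. -/
noncomputable def roundingQuotient (z : Fin n → ℝ) : ℝ := -(z ⬝ᵥ (A *ᵥ z)) / absVolume A z

/-- The entries of `x` that lie in `[t, t * B)` in absolute value, divided by `t * B`. -/
noncomputable def windowVec (x : Fin n → ℝ) (t B : ℝ) (i : Fin n) : ℝ :=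
  if t ≤ |x i| ∧ |x i| < t * B then x i / (t * B) else 0

theorem abs_windowVec_le_one (x : Fin n → ℝ) (t B : ℝ) (i : Fin n) : |windowVec x t B i| ≤ 1 := by
  rw [windowVec]
  split_ifs with h
  · have h0 : 0 ≤ t * B := (abs_nonneg _).trans h.2.le
    rw [abs_div, abs_of_nonneg h0]
    exact div_le_one_of_le₀ h.2.le h0
  · simp

theorem abs_windowVec_le_mul_sq {x : Fin n → ℝ} {t B : ℝ} (ht : 0 < t) (hB : 0 < B) (i : Fin n) :
    |windowVec x t B i| ≤ B * (windowVec x t B i * windowVec x t B i) := by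
  rw [← abs_mul_abs_self (windowVec x t B i), windowVec]
  split_ifs with h
  · have h1 : 1 ≤ B * |x i / (t * B)| := by
      rw [abs_div, abs_of_pos (by positivity : 0 < t * B), mul_div_assoc', le_div_iff₀ (by positivity)]
      nlinarith [h.1]
    nlinarith [abs_nonneg (x i / (t * B))]
  · simp

/-- A window can be moved so that its lower or its upper end is an entry of `x`. -/
theorem exists_window_at_entry {x : Fin n → ℝ} {t B : ℝ} (ht : 0 < t) (hB : 0 < B)
    (hne : ∃ i, t ≤ |x i|) :
    ∃ v t', (t' = |x v| ∨ t' = |x v| / B) ∧ 0 < t' ∧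
      ∀ i, (t' ≤ |x i| ∧ |x i| < t' * B) ↔ (t ≤ |x i| ∧ |x i| < t * B) := by
  set S : Finset ℝ := (Finset.univ.image (fun v => |x v|) ∪ Finset.univ.image (fun v => |x v| / B)).filter
    (t ≤ ·) with hS
  have hmem1 : ∀ i, t ≤ |x i| → |x i| ∈ S := fun i h => by simp [hS, h]
  have hmem2 : ∀ i, t ≤ |x i| / B → |x i| / B ∈ S := fun i h => by simp [hS, h]
  obtain ⟨i₀, hi₀⟩ := hne
  have hSne : S.Nonempty := ⟨_, hmem1 i₀ hi₀⟩
  set t' := S.min' hSne with ht'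
  have hmin : ∀ r ∈ S, t' ≤ r := fun r hr => S.min'_le r hr
  have htS : t' ∈ S := S.min'_mem hSne
  have htt : t ≤ t' := (Finset.mem_filter.mp htS).2
  have hv : ∃ v, t' = |x v| ∨ t' = |x v| / B := by
    have := (Finset.mem_filter.mp htS).1
    simp only [Finset.mem_union, Finset.mem_image, Finset.mem_univ, true_and] at this
    rcases this with ⟨v, hv⟩ | ⟨v, hv⟩
    exacts [⟨v, .inl hv.symm⟩, ⟨v, .inr hv.symm⟩]
  obtain ⟨v, hv⟩ := hv
  refine ⟨v, t', hv, ht.trans_le htt, fun i => ⟨fun h => ⟨htt.trans h.1, ?_⟩, fun h =>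
    ⟨hmin _ (hmem1 i h.1), h.2.trans_le (by gcongr)⟩⟩⟩
  by_contra! hcon
  have h1 := hmin _ (hmem2 i ((le_div_iff₀ hB).mpr hcon))
  exact absurd h.2 (not_lt.mpr ((le_div_iff₀ hB).mp h1))

/-- The form `xᵀ A x` restricted to a random window of `L` consecutive binary orders of magnitude
loses little compared to `xᵀ D x`, hence some window has almost as large a quotient as `x`. -/
theorem exists_dyadic_window (hA : A.IsSymm) {δ : ℝ} (hδ : 0 < δ) {x : Fin n → ℝ}
    (hx : δ ≤ gainQuotient A x) {L : ℕ} (hL : 4 < δ * L) :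
    ∃ t : ℝ, 0 < t ∧ δ / 2 * ∑ i, wdeg A i *
        (if t ≤ |x i| ∧ |x i| < t * 2 ^ L then x i * x i else 0) <
      ∑ i, ∑ j, -A i j * (if (t ≤ |x i| ∧ |x i| < t * 2 ^ L) ∧ (t ≤ |x j| ∧ |x j| < t * 2 ^ L) then
        x i * x j else 0) := by
  have hL0 : 0 < L := by
    rcases Nat.eq_zero_or_pos L with rfl | h
    · norm_num at hL
    · exact h
  set N := ∑ i, wdeg A i * (x i * x i) with hN
  set Q := ∑ i, ∑ j, -A i j * (x i * x j) with hQ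
  have hQ' : Q = -(x ⬝ᵥ (A *ᵥ x)) := by
    rw [dotProduct_mulVec_eq_sum, hQ]; simp
  have hNpos : 0 < N := by
    rw [hN, ← dotProduct_degMatrix]
    refine (degMatrix_form_nonneg x).lt_of_ne fun h => ?_
    rw [gainQuotient, ← h, div_zero] at hx
    linarith
  have hQN : δ * N ≤ Q := by
    rw [gainQuotient, dotProduct_degMatrix, ← hN, le_div_iff₀ hNpos, ← hQ'] at hx
    exact hx
  set b : Fin n → ℤ := fun i => Int.log 2 |x i| with hb
  have hsep : ∑ a ∈ Finset.range L, ∑ i, ∑ j,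
      (if (b i + a) / (L : ℤ) = (b j + a) / (L : ℤ) then 0 else -A i j * (x i * x j)) ≤ 2 * N := by
    have h2N : 2 * N = ∑ i, ∑ j, |A i j| * (|x i| * |x i| + |x j| * |x j|) := by
      simp only [mul_add, Finset.sum_add_distrib]
      rw [sum_sum_abs_mul_left (fun i => |x i| * |x i|),
        sum_sum_abs_mul_right hA (fun i => |x i| * |x i|)]
      simp only [abs_mul_abs_self]
      rw [← hN, two_mul]
    rw [h2N, Finset.sum_comm]
    refine Finset.sum_le_sum fun i _ => ?_
    rw [Finset.sum_comm]
    refine Finset.sum_le_sum fun j _ => ?_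
    calc _ ≤ ∑ a ∈ Finset.range L, (if (b i + a) / (L : ℤ) ≠ (b j + a) / (L : ℤ) then
          |A i j| * (|x i| * |x j|) else 0) := by
          refine Finset.sum_le_sum fun a _ => ?_
          by_cases h : (b i + a) / (L : ℤ) = (b j + a) / (L : ℤ)
          · simp [h]
          · rw [if_neg h, if_pos h, ← abs_mul, ← abs_mul, neg_mul]
            exact neg_le_abs _
      _ = ((Finset.range L).filter fun a : ℕ =>
            (b i + a) / (L : ℤ) ≠ (b j + a) / (L : ℤ)).card * (|A i j| * (|x i| * |x j|)) := by
          rw [← Finset.sum_filter, Finset.sum_const, nsmul_eq_mul]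
      _ ≤ (b i - b j).natAbs * (|A i j| * (|x i| * |x j|)) := by
          gcongr
          exact card_filter_ediv_ne_le hL0 _ _
      _ = |A i j| * ((b i - b j).natAbs * (|x i| * |x j|)) := by ring
      _ ≤ _ := by
          gcongr
          exact natAbs_log_sub_log_mul_le (abs_nonneg _) (abs_nonneg _)
  have hsum : 0 < ∑ a ∈ Finset.range L, (∑ i, ∑ j,
      (if (b i + a) / (L : ℤ) = (b j + a) / (L : ℤ) then -A i j * (x i * x j) else 0) -
        ∑ i, δ / 2 * (wdeg A i * (x i * x i))) := by
    have hsplit : ∀ a ∈ Finset.range L, (∑ i, ∑ j,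
        (if (b i + a) / (L : ℤ) = (b j + a) / (L : ℤ) then -A i j * (x i * x j) else 0) -
        ∑ i, δ / 2 * (wdeg A i * (x i * x i))) = (Q - δ / 2 * N) - ∑ i, ∑ j,
      (if (b i + a) / (L : ℤ) = (b j + a) / (L : ℤ) then 0 else -A i j * (x i * x j)) := by
      intro a _
      rw [← Finset.mul_sum, ← hN, hQ, sub_right_comm, ← Finset.sum_sub_distrib]
      congr 1
      refine Finset.sum_congr rfl fun i _ => ?_
      rw [← Finset.sum_sub_distrib]
      refine Finset.sum_congr rfl fun j _ => ?_
      split_ifs <;> simp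
    rw [Finset.sum_congr rfl hsplit, Finset.sum_sub_distrib, Finset.sum_const, Finset.card_range,
      nsmul_eq_mul]
    have h1 : (L : ℝ) * (δ / 2 * N) ≤ L * (Q - δ / 2 * N) := by
      gcongr; linarith
    nlinarith
  obtain ⟨a, -, ha⟩ := Finset.exists_lt_of_sum_lt (s := Finset.range L) (f := fun _ => (0 : ℝ))
    (Finset.sum_const_zero.trans_lt hsum)
  obtain ⟨q, hq⟩ := exists_class_pos (fun i => (b i + a) / (L : ℤ))
    (fun i j => -A i j * (x i * x j)) (fun i => δ / 2 * (wdeg A i * (x i * x i))) ha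
  have hiff : ∀ i, x i ≠ 0 → ((b i + a) / (L : ℤ) = q ↔
      (2 : ℝ) ^ (q * L - a) ≤ |x i| ∧ |x i| < 2 ^ (q * L - a) * 2 ^ L) := by
    intro i hi
    have hL' : (0 : ℤ) < L := by exact_mod_cast hL0
    have hxi : 0 < |x i| := abs_pos.mpr hi
    have e1 : (2 : ℝ) ^ (q * L - a) ≤ |x i| ↔ q * L - a ≤ b i :=
      Int.zpow_le_iff_le_log one_lt_two hxi
    have e2 : |x i| < (2 : ℝ) ^ (q * L - a + L) ↔ b i < q * L - a + L :=
      Int.lt_zpow_iff_log_lt one_lt_two hxi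
    rw [← zpow_natCast, ← zpow_add₀ two_ne_zero, e1, e2, Int.ediv_eq_iff_of_pos hL']
    constructor <;> rintro ⟨h1, h2⟩ <;> constructor <;> linarith
  refine ⟨2 ^ (q * L - a), by positivity, ?_⟩
  rw [← sub_pos]
  refine hq.trans_eq (congrArg₂ _ ?_ ?_)
  · refine Finset.sum_congr rfl fun i _ => Finset.sum_congr rfl fun j _ => ?_
    by_cases hi : x i = 0
    · simp [hi]
    by_cases hj : x j = 0
    · simp [hj]
    simp only [hiff i hi, hiff j hj, mul_ite, mul_zero]
  · rw [Finset.mul_sum]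
    refine Finset.sum_congr rfl fun i _ => ?_
    by_cases hi : x i = 0
    · simp [hi]
    simp only [hiff i hi, mul_ite, mul_zero]

theorem exists_window (hA : A.IsSymm) {δ : ℝ} (hδ : 0 < δ) {x : Fin n → ℝ}
    (hx : δ ≤ gainQuotient A x) {L : ℕ} (hL : 4 < δ * L) :
    ∃ v t, (t = |x v| ∨ t = |x v| / 2 ^ L) ∧
      δ / 2 / 2 ^ L ≤ roundingQuotient A (windowVec x t (2 ^ L)) := by
  obtain ⟨t₀, ht₀, hwin⟩ := exists_dyadic_window hA hδ hx hL
  have hB : (0 : ℝ) < 2 ^ L := by positivity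
  have hne : ∃ i, t₀ ≤ |x i| := by
    by_contra! hcon
    simp [not_le.mpr (hcon _)] at hwin
  obtain ⟨v, t, htv, ht, hiff⟩ := exists_window_at_entry ht₀ hB hne
  refine ⟨v, t, htv, ?_⟩
  simp only [← hiff] at hwin
  set z := windowVec x t (2 ^ L) with hz
  set D := ∑ i, wdeg A i * (z i * z i) with hD
  set r := t * 2 ^ L with hr
  have hr0 : 0 < r := by positivity
  have hform : δ / 2 * D < -(z ⬝ᵥ (A *ᵥ z)) := by
    have h1 : D = (∑ i, wdeg A i * (if t ≤ |x i| ∧ |x i| < r then x i * x i else 0)) / (r * r) := by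
      rw [hD, Finset.sum_div]
      refine Finset.sum_congr rfl fun i _ => ?_
      simp only [hz, windowVec]
      split_ifs
      · rw [div_mul_div_comm, hr]; ring
      · simp
    have h2 : -(z ⬝ᵥ (A *ᵥ z)) = (∑ i, ∑ j, -A i j * (if (t ≤ |x i| ∧ |x i| < r) ∧
        (t ≤ |x j| ∧ |x j| < r) then x i * x j else 0)) / (r * r) := by
      rw [dotProduct_mulVec_eq_sum, ← Finset.sum_neg_distrib, Finset.sum_div]
      refine Finset.sum_congr rfl fun i _ => ?_
      rw [← Finset.sum_neg_distrib, Finset.sum_div]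
      refine Finset.sum_congr rfl fun j _ => ?_
      simp only [hz, windowVec]
      by_cases hi : t ≤ |x i| ∧ |x i| < r <;> by_cases hj : t ≤ |x j| ∧ |x j| < r <;>
        simp [hi, hj, ← hr]
      field_simp
    rw [h1, h2, ← mul_div_assoc]
    exact div_lt_div_of_pos_right hwin (by positivity)
  have hvol : absVolume A z ≤ 2 ^ L * D := by
    rw [absVolume, hD, Finset.mul_sum]
    refine Finset.sum_le_sum fun i _ => ?_
    calc _ ≤ wdeg A i * (2 ^ L * (z i * z i)) :=
          mul_le_mul_of_nonneg_left (abs_windowVec_le_mul_sq ht hB i) (wdeg_nonneg i)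
      _ = _ := by ring
  have hDpos : 0 < D := by
    have h0 : 0 ≤ D := Finset.sum_nonneg fun i _ => mul_nonneg (wdeg_nonneg i) (mul_self_nonneg _)
    refine h0.lt_of_ne fun h => ?_
    have h1 := neg_form_le hA z
    rw [dotProduct_degMatrix, ← hD] at h1
    nlinarith
  have hvpos : 0 < absVolume A z := by
    refine hDpos.trans_le (Finset.sum_le_sum fun i _ => mul_le_mul_of_nonneg_left ?_ (wdeg_nonneg i))
    rw [← abs_mul_abs_self]
    exact mul_le_of_le_one_left (abs_nonneg _) (abs_windowVec_le_one x t _ i)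
  rw [roundingQuotient, le_div_iff₀ hvpos]
  calc δ / 2 / 2 ^ L * absVolume A z ≤ δ / 2 / 2 ^ L * (2 ^ L * D) := by gcongr
    _ = δ / 2 * D := by field_simp
    _ ≤ _ := hform.le

/-! ### Rounding -/

variable (A) in
/-- The Lagrangian `- zᵀ A z - θ ∑ d_i |z_i|` of the quotient `roundingQuotient`. -/
noncomputable def lagrangian (θ : ℝ) (z : Fin n → ℝ) : ℝ := -(z ⬝ᵥ (A *ᵥ z)) - θ * absVolume A z

/-- Since `A` has zero diagonal, the Lagrangian is an affine function of `a` and `|a|` when a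
coordinate is set to `a`. -/
theorem lagrangian_update (hA : A.IsSymm) (hdiag : ∀ i, A i i = 0) (θ : ℝ) (z : Fin n → ℝ)
    (i : Fin n) (a : ℝ) :
    lagrangian A θ (Function.update z i a) = lagrangian A θ z +
      (-2 * (A *ᵥ z) i * a - θ * wdeg A i * |a|) -
      (-2 * (A *ᵥ z) i * z i - θ * wdeg A i * |z i|) := by
  have hu : Function.update z i a = z + (a - z i) • Pi.single i 1 := by
    ext j
    rcases eq_or_ne j i with rfl | h <;> simp [*]
  have hvol : absVolume A (Function.update z i a) =
      absVolume A z + wdeg A i * |a| - wdeg A i * |z i| := by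
    simp only [absVolume]
    rw [← Finset.add_sum_erase _ _ (Finset.mem_univ i),
      ← Finset.add_sum_erase _ (fun l => wdeg A l * |z l|) (Finset.mem_univ i),
      Finset.sum_congr rfl fun j hj => by
        rw [Function.update_of_ne (Finset.ne_of_mem_erase hj)]]
    simp only [Function.update_self]
    ring
  have hz : z ⬝ᵥ (A *ᵥ Pi.single i 1) = (A *ᵥ z) i := by
    rw [Matrix.dotProduct_mulVec, ← Matrix.mulVec_transpose, hA.eq]; simp
  rw [lagrangian, lagrangian, hvol, hu, Matrix.mulVec_add, Matrix.mulVec_smul]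
  simp only [dotProduct_add, add_dotProduct, smul_dotProduct, dotProduct_smul, hz, smul_eq_mul]
  simp [hdiag]
  ring

theorem lagrangian_le_update_neg_one (hA : A.IsSymm) (hdiag : ∀ i, A i i = 0) {θ : ℝ}
    {z : Fin n → ℝ} {i : Fin n} (hz : |z i| ≤ 1) (h : θ * wdeg A i < 2 * (A *ᵥ z) i)
    (hθ : 0 ≤ θ) : lagrangian A θ z ≤ lagrangian A θ (Function.update z i (-1)) := by
  rw [lagrangian_update hA hdiag, abs_neg, abs_one]
  have h0 := mul_nonneg hθ (wdeg_nonneg (A := A) i)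
  nlinarith [neg_abs_le (z i), abs_nonneg (z i)]

theorem lagrangian_le_update_one (hA : A.IsSymm) (hdiag : ∀ i, A i i = 0) {θ : ℝ}
    {z : Fin n → ℝ} {i : Fin n} (hz : |z i| ≤ 1) (h : θ * wdeg A i < -(2 * (A *ᵥ z) i))
    (hθ : 0 ≤ θ) : lagrangian A θ z ≤ lagrangian A θ (Function.update z i 1) := by
  rw [lagrangian_update hA hdiag, abs_one]
  have h0 := mul_nonneg hθ (wdeg_nonneg (A := A) i)
  nlinarith [le_abs_self (z i), abs_nonneg (z i)]

theorem lagrangian_le_update_zero (hA : A.IsSymm) (hdiag : ∀ i, A i i = 0) {θ : ℝ}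
    {z : Fin n → ℝ} {i : Fin n} (h₁ : 2 * (A *ᵥ z) i ≤ θ * wdeg A i)
    (h₂ : -(2 * (A *ᵥ z) i) ≤ θ * wdeg A i) :
    lagrangian A θ z ≤ lagrangian A θ (Function.update z i 0) := by
  rw [lagrangian_update hA hdiag, abs_zero]
  have h3 : |2 * (A *ᵥ z) i| ≤ θ * wdeg A i := abs_le.mpr ⟨by linarith, h₁⟩
  have h4 : -(2 * (A *ᵥ z) i * z i) ≤ |2 * (A *ᵥ z) i| * |z i| := by
    rw [← abs_mul]; exact neg_le_abs _
  nlinarith [abs_nonneg (z i), mul_le_mul_of_nonneg_right h3 (abs_nonneg (z i))]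

/-- A rounding that does not decrease the Lagrangian with `θ` half of the quotient has at least half
of the quotient. -/
theorem half_le_gainQuotient_of_lagrangian_le (hA : A.IsSymm) {ρ : ℝ} (hρ : 0 < ρ)
    {z y : Fin n → ℝ} (hz : roundingQuotient A z = ρ) (hy : ∀ i, y i = -1 ∨ y i = 1 ∨ y i = 0)
    (h : lagrangian A (ρ / 2) z ≤ lagrangian A (ρ / 2) y) :
    0 < y ⬝ᵥ (degMatrix A *ᵥ y) ∧ ρ / 2 ≤ gainQuotient A y := by
  have hvol : absVolume A y = y ⬝ᵥ (degMatrix A *ᵥ y) := by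
    rw [dotProduct_degMatrix, absVolume]
    refine Finset.sum_congr rfl fun i _ => ?_
    rcases hy i with h | h | h <;> simp [h]
  have hzpos : 0 < absVolume A z := by
    refine lt_of_le_of_ne (Finset.sum_nonneg fun i _ => mul_nonneg (wdeg_nonneg i) (abs_nonneg _))
      fun h0 => ?_
    rw [roundingQuotient, ← h0, div_zero] at hz
    exact hρ.ne hz
  have hnum : -(z ⬝ᵥ (A *ᵥ z)) = ρ * absVolume A z := by
    rw [← hz, roundingQuotient, div_mul_cancel₀ _ hzpos.ne']
  have hLz : 0 < lagrangian A (ρ / 2) z := by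
    rw [lagrangian, hnum]; nlinarith
  have hLy := hLz.trans_le h
  rw [lagrangian, hvol] at hLy
  have hD := degMatrix_form_nonneg (A := A) y
  have hDpos : 0 < y ⬝ᵥ (degMatrix A *ᵥ y) := by
    have := neg_form_le hA y
    nlinarith
  refine ⟨hDpos, ?_⟩
  rw [gainQuotient, le_div_iff₀ hDpos]
  linarith

end WeightedGraph

namespace RealRAM

/-! ### A program logic with running times -/

/-- Whether the program contains an assignment to the natural-number array `a`. -/
def Prog.writesNat (a : ℕ) : Prog → Bool
  | .skip => false
  | .setNat b _ _ => a == b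
  | .setReal _ _ _ => false
  | .seq p q => p.writesNat a || q.writesNat a
  | .branch _ p q => p.writesNat a || q.writesNat a
  | .loop _ p => p.writesNat a

/-- Whether the program contains an assignment to the real array `a`. -/
def Prog.writesReal (a : ℕ) : Prog → Bool
  | .skip => false
  | .setNat _ _ _ => false
  | .setReal b _ _ => a == b
  | .seq p q => p.writesReal a || q.writesReal a
  | .branch _ p q => p.writesReal a || q.writesReal a
  | .loop _ p => p.writesReal a

/-- `p.Frame s s'`: the states `s` and `s'` agree on all arrays to which `p` does not assign. -/
structure Prog.Frame (p : Prog) (s s' : State) : Prop where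
  nat : ∀ a, p.writesNat a = false → s'.nat a = s.nat a
  real : ∀ a, p.writesReal a = false → s'.real a = s.real a

theorem Prog.Frame.rfl {p : Prog} {s : State} : p.Frame s s := ⟨fun _ _ => Eq.refl _, fun _ _ => Eq.refl _⟩

theorem Prog.Frame.trans {p : Prog} {s s' s'' : State} (h : p.Frame s s') (h' : p.Frame s' s'') :
    p.Frame s s'' :=
  ⟨fun a ha => (h'.nat a ha).trans (h.nat a ha), fun a ha => (h'.real a ha).trans (h.real a ha)⟩

theorem Prog.Frame.mono {p q : Prog} {s s' : State} (h : p.Frame s s')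
    (hn : ∀ a, q.writesNat a = false → p.writesNat a = false)
    (hr : ∀ a, q.writesReal a = false → p.writesReal a = false) : q.Frame s s' :=
  ⟨fun a ha => h.nat a (hn a ha), fun a ha => h.real a (hr a ha)⟩

@[simp] theorem State.writeNat_real (s : State) (a i v : ℕ) : (s.writeNat a i v).real = s.real := rfl

@[simp] theorem State.writeReal_nat (s : State) (a i : ℕ) (v : ℝ) :
    (s.writeReal a i v).nat = s.nat := rfl

theorem State.writeNat_nat_self (s : State) (a i v : ℕ) :
    (s.writeNat a i v).nat a = Function.update (s.nat a) i v := by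
  simp [State.writeNat]

theorem State.writeNat_nat_of_ne (s : State) {a b : ℕ} (i v : ℕ) (h : b ≠ a) :
    (s.writeNat a i v).nat b = s.nat b := by
  simp [State.writeNat, h]

theorem State.writeReal_real_self (s : State) (a i : ℕ) (v : ℝ) :
    (s.writeReal a i v).real a = Function.update (s.real a) i v := by
  simp [State.writeReal]

theorem State.writeReal_real_of_ne (s : State) {a b : ℕ} (i : ℕ) (v : ℝ) (h : b ≠ a) :
    (s.writeReal a i v).real b = s.real b := by
  simp [State.writeReal, h]

theorem Exec.frame {p : Prog} {s s' : State} {t : ℕ} (h : Exec p s s' t) : p.Frame s s' := by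
  induction h with
  | skip => exact .rfl
  | setNat s a i x =>
    refine ⟨fun b hb => ?_, fun b _ => rfl⟩
    exact State.writeNat_nat_of_ne _ _ _ (by simpa [Prog.writesNat] using hb)
  | setReal s a i x =>
    refine ⟨fun b _ => rfl, fun b hb => ?_⟩
    exact State.writeReal_real_of_ne _ _ _ (by simpa [Prog.writesReal] using hb)
  | seq _ _ ih ih' =>
    refine (ih.mono ?_ ?_).trans (ih'.mono ?_ ?_) <;> intro a <;>
      simp +contextual [Prog.writesNat, Prog.writesReal]
  | branchTrue _ _ ih =>
    refine ih.mono ?_ ?_ <;> intro a <;> simp +contextual [Prog.writesNat, Prog.writesReal]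
  | branchFalse _ _ ih =>
    refine ih.mono ?_ ?_ <;> intro a <;> simp +contextual [Prog.writesNat, Prog.writesReal]
  | loopDone => exact .rfl
  | loopStep _ _ _ ih ih' => exact Prog.Frame.trans (ih.mono (fun _ h => h) (fun _ h => h)) ih'

/-- Total correctness with a time bound: started in `s`, the program `p` halts after at most `T`
steps in a state that satisfies `Q`. -/
def Runs (p : Prog) (s : State) (T : ℕ) (Q : State → Prop) : Prop :=
  ∃ s' t, Exec p s s' t ∧ t ≤ T ∧ Q s'

theorem Runs.mono {p : Prog} {s : State} {T T' : ℕ} {Q Q' : State → Prop} (h : Runs p s T Q)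
    (hT : T ≤ T') (hQ : ∀ s', p.Frame s s' → Q s' → Q' s') : Runs p s T' Q' := by
  obtain ⟨s', t, he, ht, hq⟩ := h
  exact ⟨s', t, he, ht.trans hT, hQ s' he.frame hq⟩

theorem Runs.skip {s : State} {Q : State → Prop} (h : Q s) : Runs .skip s 1 Q :=
  ⟨s, 1, .skip s, le_rfl, h⟩

theorem Runs.setNat {s : State} {a : ℕ} {i x : NExpr} {Q : State → Prop}
    (h : Q (s.writeNat a (i.eval s) (x.eval s))) :
    Runs (.setNat a i x) s (i.cost + x.cost + 1) Q :=
  ⟨_, _, .setNat s a i x, le_rfl, h⟩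

theorem Runs.setReal {s : State} {a : ℕ} {i : NExpr} {x : RExpr} {Q : State → Prop}
    (h : Q (s.writeReal a (i.eval s) (x.eval s))) :
    Runs (.setReal a i x) s (i.cost + x.cost + 1) Q :=
  ⟨_, _, .setReal s a i x, le_rfl, h⟩

theorem Runs.seq {p q : Prog} {s : State} {T₁ T₂ : ℕ} {Q₁ Q : State → Prop}
    (hp : Runs p s T₁ Q₁) (hq : ∀ s', p.Frame s s' → Q₁ s' → Runs q s' T₂ Q) :
    Runs (.seq p q) s (T₁ + T₂) Q := by
  obtain ⟨s₁, t₁, he₁, ht₁, h₁⟩ := hp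
  obtain ⟨s₂, t₂, he₂, ht₂, h₂⟩ := hq s₁ he₁.frame h₁
  exact ⟨s₂, _, .seq he₁ he₂, add_le_add ht₁ ht₂, h₂⟩

theorem Runs.setNat_seq {q : Prog} {s : State} {a T : ℕ} {i x : NExpr} {Q : State → Prop}
    (h : Runs q (s.writeNat a (i.eval s) (x.eval s)) T Q) :
    Runs (.seq (.setNat a i x) q) s (i.cost + x.cost + 1 + T) Q := by
  obtain ⟨s', t, he, ht, hq⟩ := h
  exact ⟨s', _, .seq (.setNat s a i x) he, by omega, hq⟩

theorem Runs.setReal_seq {q : Prog} {s : State} {a T : ℕ} {i : NExpr} {x : RExpr}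
    {Q : State → Prop} (h : Runs q (s.writeReal a (i.eval s) (x.eval s)) T Q) :
    Runs (.seq (.setReal a i x) q) s (i.cost + x.cost + 1 + T) Q := by
  obtain ⟨s', t, he, ht, hq⟩ := h
  exact ⟨s', _, .seq (.setReal s a i x) he, by omega, hq⟩

theorem Runs.branch {b : Test} {p q : Prog} {s : State} {T : ℕ} {Q : State → Prop}
    (hp : b.holds s → Runs p s T Q) (hq : ¬ b.holds s → Runs q s T Q) :
    Runs (.branch b p q) s (b.cost + T) Q := by
  by_cases hb : b.holds s
  · obtain ⟨s', t, he, ht, h⟩ := hp hb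
    exact ⟨s', _, .branchTrue hb he, by omega, h⟩
  · obtain ⟨s', t, he, ht, h⟩ := hq hb
    exact ⟨s', _, .branchFalse hb he, by omega, h⟩

/-- The content of cell `j` of the natural-number array `a`. -/
abbrev cell (a j : ℕ) : NExpr := .load a (.const j)

/-- Run `body` with the counter `c` (cell `0` of the array `c`) running through the numbers below
the content of cell `j` of the array `a`. -/
def forLoop (c a j : ℕ) (body : Prog) : Prog :=
  .seq (.setNat c (.const 0) (.const 0))
    (.loop (.natLt (cell c 0) (cell a j))
      (.seq body (.setNat c (.const 0) (.add (cell c 0) (.const 1)))))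

/-- The invariant rule for counting loops.  The invariant must not depend on the loop counter, which is
already increased when the next round begins. -/
theorem runs_forLoop {c a j N : ℕ} {body : Prog} {s : State} {T : ℕ} (hN : s.nat a j = N)
    (I : ℕ → State → Prop)
    (hc : body.writesNat c = false) (ha : body.writesNat a = false) (hac : a ≠ c)
    (hI : ∀ i s₁ s₂, (∀ b ≠ c, s₂.nat b = s₁.nat b) → s₂.real = s₁.real → I i s₁ → I i s₂)
    (h0 : I 0 s)
    (hstep : ∀ i < N, ∀ s', s'.nat c 0 = i → (forLoop c a j body).Frame s s' → I i s' →
      Runs body s' T (I (i + 1))) :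
    Runs (forLoop c a j body) s (8 + N * (11 + T)) (I N) := by
  subst hN
  have hwa : (forLoop c a j body).writesNat a = false := by
    simp [forLoop, Prog.writesNat, ha, hac]
  have key : ∀ k i s', i + k = s.nat a j → s'.nat c 0 = i →
      (forLoop c a j body).Frame s s' → I i s' →
      Runs (.loop (.natLt (cell c 0) (cell a j))
        (.seq body (.setNat c (.const 0) (.add (cell c 0) (.const 1))))) s'
        (5 + k * (11 + T)) (I (s.nat a j)) := by
    intro k
    induction k with
    | zero =>
      intro i s' hik hi hF hIs
      refine ⟨s', _, .loopDone ?_, ?_, ?_⟩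
      · simp only [Test.holds, NExpr.eval, hi, hF.nat a hwa]; omega
      · simp [Test.cost, NExpr.cost]
      · rwa [← hik]
    | succ k ih =>
      intro i s' hik hi hF hIs
      obtain ⟨s₁, t₁, he₁, ht₁, hI₁⟩ := hstep i (by omega) s' hi hF hIs
      have hF₁ := he₁.frame
      have hs := Exec.setNat s₁ c (.const 0) (.add (cell c 0) (.const 1))
      have he := Exec.seq he₁ hs
      have hcs : s₁.nat c 0 = i := by rw [hF₁.nat c hc, hi]
      obtain ⟨s₂, t₂, he₂, ht₂, hI₂⟩ := ih (i + 1) _ (by omega)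
        (by rw [State.writeNat_nat_self]; simp [NExpr.eval, hcs])
        (hF.trans (he.frame.mono
          (by intro b; simp +contextual [forLoop, Prog.writesNat])
          (by intro b; simp +contextual [forLoop, Prog.writesReal])))
        (hI (i + 1) s₁ _ (fun b hb => State.writeNat_nat_of_ne _ _ _ hb) rfl hI₁)
      refine ⟨s₂, _, .loopStep ?_ he he₂, ?_, hI₂⟩
      · simp only [Test.holds, NExpr.eval, hi, hF.nat a hwa]; omega
      · simp only [Test.cost, NExpr.cost]
        nlinarith
  have := Runs.seq (Runs.setNat (a := c) (i := .const 0) (x := .const 0)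
    (Q := fun s' => s' = s.writeNat c 0 0) (s := s) rfl)
    (T₂ := 5 + s.nat a j * (11 + T)) (Q := I (s.nat a j))
    (q := .loop (.natLt (cell c 0) (cell a j))
        (.seq body (.setNat c (.const 0) (.add (cell c 0) (.const 1)))))
    (fun s' hF hs' => by
      subst hs'
      refine key _ 0 _ (by omega) ?_ (hF.mono ?_ ?_) ?_
      · rw [State.writeNat_nat_self]; simp
      · intro b; simp +contextual [forLoop, Prog.writesNat]
      · intro b; simp [Prog.writesReal]
      · exact hI 0 s _ (fun b hb => State.writeNat_nat_of_ne _ _ _ hb) rfl h0)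
  refine Runs.mono this ?_ (fun _ _ h => h)
  simp [NExpr.cost]; omega

/-- A loop whose `i`-th round assigns `f i` to cell `i` of the real array `d`. -/
theorem runs_map {c a j d N : ℕ} {body : Prog} {s : State} {T : ℕ} (hN : s.nat a j = N)
    (f : ℕ → ℝ)
    (hc : body.writesNat c = false) (ha : body.writesNat a = false) (hac : a ≠ c)
    (hstep : ∀ i < N, ∀ s', s'.nat c 0 = i → (forLoop c a j body).Frame s s' →
      s'.real d i = s.real d i →
      Runs body s' T (fun s'' => s''.real d = Function.update (s'.real d) i (f i))) :
    Runs (forLoop c a j body) s (8 + N * (11 + T))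
      (fun s' => ∀ i, s'.real d i = if i < N then f i else s.real d i) := by
  refine runs_forLoop hN
    (I := fun i s' => ∀ l, s'.real d l = if l < i then f l else s.real d l) hc ha hac ?_ ?_ ?_
  · intro i s₁ s₂ _ h h1; rwa [h]
  · simp
  · intro i hi s' hc' hF hIs
    refine (hstep i hi s' hc' hF (by simp [hIs])).mono le_rfl ?_
    intro s'' _ h l
    rw [h]
    rcases lt_trichotomy l i with hl | rfl | hl
    · rw [Function.update_of_ne hl.ne, hIs, if_pos hl, if_pos (by omega)]
    · simp
    · rw [Function.update_of_ne hl.ne', hIs, if_neg (by omega), if_neg (by omega)]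

/-- Store the sum of the values of `e` in cell `0` of the real array `r`. -/
def sumLoop (c a j r : ℕ) (e : RExpr) : Prog :=
  .seq (.setReal r (.const 0) (.const 0))
    (forLoop c a j (.setReal r (.const 0) (.add (.load r (.const 0)) e)))

theorem runs_sumLoop {c a j r N : ℕ} {e : RExpr} {s : State} (hN : s.nat a j = N)
    (f : ℕ → ℝ) (hac : a ≠ c)
    (he : ∀ i < N, ∀ s', s'.nat c 0 = i → (sumLoop c a j r e).Frame s s' →
      e.eval s' = f i) :
    Runs (sumLoop c a j r e) s (11 + N * (16 + e.cost))
      (fun s' => s'.real r 0 = ∑ i ∈ Finset.range (N), f i) := by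
  refine Runs.mono (Runs.seq (Runs.setReal (Q := fun s' => s'.real r 0 = 0) ?_) (fun s₁ hF h1 => ?_)
    (T₂ := 8 + N * (11 + (5 + e.cost)))) ?_ (fun _ _ h => h)
  · simp [State.writeReal, RExpr.eval, NExpr.eval]
  · have hn : s₁.nat = s.nat := by funext b; exact hF.nat b rfl
    refine Runs.mono (runs_forLoop (T := 5 + e.cost) (hn ▸ hN)
      (I := fun i s' => s'.real r 0 = ∑ l ∈ Finset.range i, f l) rfl rfl hac ?_ ?_ ?_) ?_ (fun _ _ h => h)
    · intro i s₁ s₂ _ h h1; rwa [h]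
    · simpa using h1
    · intro i hi s' hc' hF' hIs
      refine Runs.mono (Runs.setReal (Q := fun s'' => s''.real r 0 = ∑ l ∈ Finset.range (i + 1), f l) ?_) ?_ (fun _ _ h => h)
      · rw [Finset.sum_range_succ, ← hIs, ← he i hi s' hc' ?_]
        · simp [State.writeReal, RExpr.eval, NExpr.eval]
        · refine (hF.mono ?_ ?_).trans (hF'.mono ?_ ?_) <;> intro b <;>
            simp +contextual [sumLoop, Prog.writesNat, Prog.writesReal]
      · simp [NExpr.cost, RExpr.cost]; omega
    · rfl
  · rw [show 11 + (5 + e.cost) = 16 + e.cost by omega]; simp only [NExpr.cost, RExpr.cost]; omega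

end RealRAM

/-! ### Edge lists -/

/-- Every edge contributes to a sum over ordered pairs of vertices in both directions. -/
theorem IsEdgeList.sum_sum_eq {n : ℕ} {A : Matrix (Fin n) (Fin n) ℝ} {es : List (Fin n × Fin n × ℝ)}
    (hE : IsEdgeList A es) (hA : A.IsSymm) (hdiag : ∀ i, A i i = 0) (h : Fin n → Fin n → ℝ → ℝ)
    (h0 : ∀ i j, h i j 0 = 0) :
    ∑ i, ∑ j, h i j (A i j) =
      (es.map fun e => h e.1 e.2.1 e.2.2 + h e.2.1 e.1 e.2.2).sum := by
  obtain ⟨hnd, hw, hcov⟩ := hE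
  set l₁ : List (Fin n × Fin n) := es.map fun e => (e.1, e.2.1) with hl₁
  set l₂ : List (Fin n × Fin n) := es.map fun e => (e.2.1, e.1) with hl₂
  have hnd₁ : l₁.Nodup := by
    refine List.Nodup.of_map (fun p => s(p.1, p.2)) ?_
    rw [hl₁, List.map_map]; exact hnd
  have hnd₂ : l₂.Nodup := by
    refine List.Nodup.of_map (fun p => s(p.2, p.1)) ?_
    rw [hl₂, List.map_map]; exact hnd
  have hne : ∀ e ∈ es, e.1 ≠ e.2.1 := fun e he h => (hw e he).2 <| by
    rw [(hw e he).1, h, hdiag]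
  have hdisj : l₁.Disjoint l₂ := by
    intro p hp₁ hp₂
    obtain ⟨e, he, rfl⟩ := List.mem_map.mp hp₁
    obtain ⟨e', he', heq⟩ := List.mem_map.mp hp₂
    rw [Prod.mk.injEq] at heq
    have hs : s(e.1, e.2.1) = s(e'.1, e'.2.1) := by
      rw [heq.1.symm, heq.2.symm, Sym2.eq_swap]
    have := List.inj_on_of_nodup_map hnd he he' hs
    subst this
    exact hne e he heq.2
  have hnd' : (l₁ ++ l₂).Nodup := List.nodup_append'.mpr ⟨hnd₁, hnd₂, hdisj⟩
  have hmem : ∀ p : Fin n × Fin n, p ∉ (l₁ ++ l₂).toFinset → h p.1 p.2 (A p.1 p.2) = 0 := by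
    intro p hp
    by_cases hA0 : A p.1 p.2 = 0
    · rw [hA0, h0]
    · obtain ⟨e, he, hs⟩ := hcov _ _ hA0
      refine absurd ?_ hp
      rw [List.mem_toFinset, List.mem_append, hl₁, hl₂, List.mem_map, List.mem_map]
      rcases Sym2.eq_iff.mp hs with ⟨h1, h2⟩ | ⟨h1, h2⟩
      · exact .inl ⟨e, he, Prod.ext h1 h2⟩
      · exact .inr ⟨e, he, Prod.ext h2 h1⟩
  rw [← Fintype.sum_prod_type' (f := fun i j => h i j (A i j)),
    ← Finset.sum_subset (Finset.subset_univ (l₁ ++ l₂).toFinset) fun p _ hp => hmem p hp,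
    List.sum_toFinset _ hnd', List.map_append, List.sum_append, hl₁, hl₂, List.map_map,
    List.map_map, List.sum_map_add]
  congr 2
  · refine List.map_congr_left fun e he => ?_
    simp [(hw e he).1]
  · refine List.map_congr_left fun e he => ?_
    simp [(hw e he).1, hA.apply]

theorem IsEdgeList.sum_row_eq {n : ℕ} {A : Matrix (Fin n) (Fin n) ℝ}
    {es : List (Fin n × Fin n × ℝ)} (hE : IsEdgeList A es) (hA : A.IsSymm)
    (hdiag : ∀ i, A i i = 0) {f : ℝ → ℝ} (hf : f 0 = 0) (x : Fin n → ℝ) (i : Fin n) :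
    ∑ j, f (A i j) * x j = (es.map fun e => (if e.1 = i then f e.2.2 * x e.2.1 else 0) +
      (if e.2.1 = i then f e.2.2 * x e.1 else 0)).sum := by
  rw [← hE.sum_sum_eq hA hdiag (fun i' j w => if i' = i then f w * x j else 0) (by simp [hf]),
    Finset.sum_comm]
  simp

namespace RealRAM

/-! ### Building blocks of the program -/

/-! The memory layout is the following.  Natural-number arrays: `4`, `5`, `6` are loop counters (from
the outermost to the innermost), `7` the index of the heaviest edge, `8` the number
`K = ⌈log₂ n⌉`, `9` the power `2 ^ K`, `10` the number `2 K²`, `11` the number `9 K`.  Real arrays: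
`1` absolute edge weights, `2` weighted degrees, `3` the vector of the power method, `4` its
product with `A` (scratch), `5` the best vector of the power method and `6` its absolute values, `7`
the current candidate for the rounding and `16` its absolute values, `8` the best candidate, `9` and
`10` numerator and denominator of a quotient, `11` and `12` the best quotients for the arrays `5` and
`8`, `13` a power of two, `14` the lower end of a window. -/

variable {n : ℕ} {es : List (Fin n × Fin n × ℝ)} {A : Matrix (Fin n) (Fin n) ℝ}

/-- The input arrays are unchanged. -/
structure Loaded (n : ℕ) (es : List (Fin n × Fin n × ℝ)) (s : State) : Prop where
  nat_zero : s.nat 0 = (inputState n es).nat 0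
  nat_one : s.nat 1 = (inputState n es).nat 1
  nat_two : s.nat 2 = (inputState n es).nat 2
  real_zero : s.real 0 = (inputState n es).real 0

theorem Loaded.frame {p : Prog} {s s' : State} (h : Loaded n es s) (hF : p.Frame s s')
    (h0 : p.writesNat 0 = false := by rfl) (h1 : p.writesNat 1 = false := by rfl)
    (h2 : p.writesNat 2 = false := by rfl) (h3 : p.writesReal 0 = false := by rfl) :
    Loaded n es s' :=
  ⟨(hF.nat 0 h0).trans h.nat_zero, (hF.nat 1 h1).trans h.nat_one,
    (hF.nat 2 h2).trans h.nat_two, (hF.real 0 h3).trans h.real_zero⟩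

theorem Loaded.numVertices {s : State} (h : Loaded n es s) : s.nat 0 0 = n := by
  simp [h.nat_zero, inputState]

theorem Loaded.numEdges {s : State} (h : Loaded n es s) : s.nat 0 1 = es.length := by
  simp [h.nat_zero, inputState]

theorem Loaded.fst {s : State} (h : Loaded n es s) {e : ℕ} (he : e < es.length) :
    s.nat 1 e = es[e].1 := by
  simp [h.nat_one, inputState, he]

theorem Loaded.snd {s : State} (h : Loaded n es s) {e : ℕ} (he : e < es.length) :
    s.nat 2 e = es[e].2.1 := by
  simp [h.nat_two, inputState, he]

theorem Loaded.weight {s : State} (h : Loaded n es s) {e : ℕ} (he : e < es.length) :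
    s.real 0 e = es[e].2.2 := by
  simp [h.real_zero, inputState, he]

/-- The first `n` cells of an array hold the vector `x`. -/
def Stores (r : ℕ → ℝ) (x : Fin n → ℝ) : Prop := ∀ i : Fin n, r i = x i

theorem sum_range_eq_of_stores {f : ℕ → ℝ} {x : Fin n → ℝ} (h : Stores f x) :
    ∑ i ∈ Finset.range n, f i = ∑ i, x i := by
  rw [← Fin.sum_univ_eq_sum_range]
  exact Finset.sum_congr rfl fun i _ => h i

/-- Multiply the vector in the array `src` by the matrix whose nonzero entries are listed in the array
`wt`, in the order of the edges. -/
def mulVecProg (wt src dst : ℕ) : Prog :=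
  .seq (forLoop 6 0 0 (.setReal dst (cell 6 0) (.const 0)))
    (forLoop 6 0 1
      (.seq
        (.setReal dst (.load 1 (cell 6 0)) (.add (.load dst (.load 1 (cell 6 0)))
          (.mul (.load wt (cell 6 0)) (.load src (.load 2 (cell 6 0))))))
        (.setReal dst (.load 2 (cell 6 0)) (.add (.load dst (.load 2 (cell 6 0)))
          (.mul (.load wt (cell 6 0)) (.load src (.load 1 (cell 6 0))))))))

theorem runs_mulVecProg {wt src dst : ℕ} {s : State} (hsrc : src ≠ dst) (hwt : wt ≠ dst)
    (hdst : dst ≠ 0) (hA : A.IsSymm) (hdiag : ∀ i, A i i = 0) (hE : IsEdgeList A es)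
    (hL : Loaded n es s) {f : ℝ → ℝ} (hf : f 0 = 0)
    (hw : ∀ e (he : e < es.length), s.real wt e = f es[e].2.2) {x : Fin n → ℝ}
    (hx : Stores (s.real src) x) :
    Runs (mulVecProg wt src dst) s (45 * (n + es.length + 1))
      (fun s' => Stores (s'.real dst) fun i => ∑ j, f (A i j) * x j) := by
  set term : Fin n → Fin n × Fin n × ℝ → ℝ := fun i e =>
    (if e.1 = i then f e.2.2 * x e.2.1 else 0) + (if e.2.1 = i then f e.2.2 * x e.1 else 0) with hterm
  have hn := hL.numVertices
  refine Runs.mono (Runs.seq (runs_map (d := dst) (T := 4) hn (fun _ => 0) rfl rfl (by decide) ?_)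
    (Q := fun s' => Stores (s'.real dst) fun i => ∑ j, f (A i j) * x j)
    (T₂ := 8 + es.length * (11 + 34)) fun s₁ hF₁ hz => ?_) ?_ (fun _ _ h => h)
  · intro i _ s' hc _ _
    refine Runs.setReal ?_
    rw [State.writeReal_real_self]
    simp [NExpr.eval, RExpr.eval, hc]
  · have hL₁ : Loaded n es s₁ := hL.frame hF₁ rfl rfl rfl
      (by simp [forLoop, Prog.writesReal, hdst.symm])
    have hr₁ : ∀ b ≠ dst, s₁.real b = s.real b := fun b hb =>
      hF₁.real b (by simp [forLoop, Prog.writesReal, hb])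
    refine Runs.mono (runs_forLoop (T := 34) hL₁.numEdges (I := fun e s' => ∀ i : Fin n,
      s'.real dst i = ((es.take e).map (term i)).sum) rfl rfl (by decide) ?_ ?_ ?_) ?_ ?_
    · intro i s₁ s₂ _ h h1; rwa [h]
    · intro i; rw [hz]; simp
    · intro e he s' hc hF hI
      have hL' : Loaded n es s' := hL₁.frame hF rfl rfl rfl
        (by simp [forLoop, Prog.writesReal, hdst.symm])
      have hr' : ∀ b ≠ dst, s'.real b = s.real b := fun b hb => by
        rw [hF.real b (by simp [forLoop, Prog.writesReal, hb]), hr₁ b hb]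
      refine Runs.seq (T₁ := 17) (T₂ := 17) (Runs.setReal (Q := fun s'' =>
        s'' = s'.writeReal dst es[e].1 (s'.real dst es[e].1 + f es[e].2.2 * x es[e].2.1)) ?_) ?_
      · simp only [NExpr.eval, RExpr.eval, hc, hL'.fst he, hL'.snd he, hr' wt hwt, hr' src hsrc,
          hw e he, hx _]
      · rintro s'' - rfl
        refine Runs.setReal ?_
        intro i
        simp only [NExpr.eval, RExpr.eval, State.writeReal_nat, hc, hL'.fst he, hL'.snd he,
          State.writeReal_real_self, State.writeReal_real_of_ne _ _ _ hwt,
          State.writeReal_real_of_ne _ _ _ hsrc, hr' wt hwt, hr' src hsrc, hw e he, hx _]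
        rw [List.take_succ_eq_append_getElem he, List.map_append, List.sum_append, ← hI i]
        simp only [List.map_cons, List.map_nil, List.sum_cons, List.sum_nil, add_zero, hterm]
        simp only [Function.update_apply, Fin.val_inj, eq_comm (a := i)]
        by_cases h1 : es[e].1 = i
        · by_cases h2 : es[e].2.1 = i <;> simp [h1, h2, add_assoc]
        · by_cases h2 : es[e].2.1 = i <;> simp [h1, Ne.symm h1, h2]
    · exact le_rfl
    · intro s' _ hI i
      rw [hI i, List.take_length]
      exact (hE.sum_row_eq hA hdiag hf x i).symm
  · omega

theorem runs_mulVecProg_weights {src dst : ℕ} {s : State} (hsrc : src ≠ dst)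
    (hdst : dst ≠ 0) (hA : A.IsSymm) (hdiag : ∀ i, A i i = 0) (hE : IsEdgeList A es)
    (hL : Loaded n es s) {x : Fin n → ℝ} (hx : Stores (s.real src) x) :
    Runs (mulVecProg 0 src dst) s (45 * (n + es.length + 1))
      (fun s' => Stores (s'.real dst) (A *ᵥ x)) :=
  runs_mulVecProg (f := id) hsrc hdst.symm hdst hA hdiag hE hL rfl (fun _ he => hL.weight he) hx

/-- Store the absolute values of the array `src` in the array `dst`; the length is the content of cell
`j` of the natural-number array `0`. -/
def absProg (j src dst : ℕ) : Prog :=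
  forLoop 6 0 j
    (.branch (.realLt (.load src (cell 6 0)) (.const 0))
      (.setReal dst (cell 6 0) (.sub (.const 0) (.load src (cell 6 0))))
      (.setReal dst (cell 6 0) (.load src (cell 6 0))))

theorem runs_absProg {j src dst N : ℕ} {s : State} (hN : s.nat 0 j = N) (h : src ≠ dst) :
    Runs (absProg j src dst) s (8 + N * 24)
      (fun s' => ∀ i < N, s'.real dst i = |s.real src i|) := by
  refine Runs.mono (runs_map (d := dst) (T := 13) hN (fun i => |s.real src i|) rfl rfl (by decide) ?_)
    le_rfl (fun s' _ h i hi => by rw [h, if_pos hi])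
  intro i _ s' hc hF _
  have hr : s'.real src = s.real src := hF.real _ (by simp [forLoop, Prog.writesReal, h])
  refine Runs.branch (T := 8) (fun hb => ?_) (fun hb => ?_)
  · refine Runs.setReal ?_
    simp only [Test.holds, RExpr.eval, NExpr.eval, hc, hr, Int.cast_zero] at hb
    simp [NExpr.eval, RExpr.eval, hc, hr, State.writeReal_real_self, abs_of_neg hb]
  · refine Runs.mono (Runs.setReal ?_) (by simp [NExpr.cost, RExpr.cost]) (fun _ _ h => h)
    simp only [Test.holds, RExpr.eval, NExpr.eval, hc, hr, Int.cast_zero, not_lt] at hb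
    simp [NExpr.eval, RExpr.eval, hc, hr, State.writeReal_real_self, abs_of_nonneg hb]

/-- Copy the vector in the array `src` to the array `dst`. -/
def copyProg (src dst : ℕ) : Prog :=
  forLoop 6 0 0 (.setReal dst (cell 6 0) (.load src (cell 6 0)))

theorem runs_copyProg {src dst : ℕ} {s : State} (h : src ≠ dst) (hL : Loaded n es s)
    {x : Fin n → ℝ} (hx : Stores (s.real src) x) :
    Runs (copyProg src dst) s (8 + n * 17) (fun s' => Stores (s'.real dst) x) := by
  have hn := hL.numVertices
  refine Runs.mono (runs_map (d := dst) (T := 6) hn (s.real src) rfl rfl (by decide) ?_)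
    le_rfl (fun s' _ h i => by rw [h, if_pos i.2, hx i])
  intro i _ s' hc hF _
  have hr : s'.real src = s.real src := hF.real _ (by simp [forLoop, Prog.writesReal, h])
  refine Runs.setReal ?_
  simp [NExpr.eval, RExpr.eval, hc, hr, State.writeReal_real_self]

/-- The quotient `- (xᵀ A x) / ∑ d_i g_i`, once numerator and denominator are computed. -/
def quotientExpr : RExpr := .div (.sub (.const 0) (.load 9 (.const 0))) (.load 10 (.const 0))

/-- Evaluate the quotient `- (xᵀ A x) / ∑ d_i g_i` for the vector `x` in the array `src`, where `g`
computes `g_i` from the counter `i` in the array `6`.  If the quotient is larger than the one in the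
register `r`, then replace the latter, and the vector in the array `best`. -/
def keepBest (src best r : ℕ) (g : RExpr) : Prog :=
  .seq (mulVecProg 0 src 4)
    (.seq (sumLoop 6 0 0 9 (.mul (.load src (cell 6 0)) (.load 4 (cell 6 0))))
      (.seq (sumLoop 6 0 0 10 (.mul (.load 2 (cell 6 0)) g))
        (.branch (.realLt (.load r (.const 0)) quotientExpr)
          (.seq (copyProg src best) (.setReal r (.const 0) quotientExpr)) .skip)))

theorem runs_keepBest {src best r : ℕ} {g : RExpr} {s : State} (hA : A.IsSymm)
    (hdiag : ∀ i, A i i = 0) (hE : IsEdgeList A es) (hL : Loaded n es s)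
    (hd : Stores (s.real 2) (wdeg A)) {x G : Fin n → ℝ} (hx : Stores (s.real src) x)
    (hg : ∀ s', (∀ a, a ≠ 4 → a ≠ 9 → a ≠ 10 → s'.real a = s.real a) →
      ∀ i : Fin n, s'.nat 6 0 = (i : ℕ) → g.eval s' = G i)
    (hsrc : src ≠ 4 ∧ src ≠ 9 ∧ src ≠ 10 ∧ src ≠ best) (hgc : g.cost ≤ 10)
    (hbest : best ≠ 9 ∧ best ≠ 10 ∧ best ≠ 4) (hr : r ≠ 4 ∧ r ≠ 9 ∧ r ≠ 10 ∧ r ≠ best) :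
    Runs (keepBest src best r g) s (120 * (n + es.length + 1)) (fun s' =>
      (s.real r 0 < -(x ⬝ᵥ (A *ᵥ x)) / (∑ i, wdeg A i * G i) ∧ Stores (s'.real best) x ∧
        s'.real r 0 = -(x ⬝ᵥ (A *ᵥ x)) / (∑ i, wdeg A i * G i)) ∨
      (-(x ⬝ᵥ (A *ᵥ x)) / (∑ i, wdeg A i * G i) ≤ s.real r 0 ∧ s'.real best = s.real best ∧
        s'.real r 0 = s.real r 0)) := by
  obtain ⟨hs4, hs9, hs10, hsb⟩ := hsrc
  obtain ⟨hb9, hb10, hb4⟩ := hbest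
  obtain ⟨hr4, hr9, hr10, hrb⟩ := hr
  have hn := hL.numVertices
  refine Runs.mono (Runs.seq (runs_mulVecProg_weights hs4 (by decide) hA hdiag hE hL hx)
    (fun s₁ hF₁ h₁ => Runs.seq (runs_sumLoop (N := n) (c := 6) (a := 0) ?_
      (fun i => s₁.real src i * s₁.real 4 i) (by decide) ?_)
    (fun s₂ hF₂ h₂ => Runs.seq (runs_sumLoop (N := n) (c := 6) (a := 0) ?_
      (fun i => if hi : i < n then wdeg A ⟨i, hi⟩ * G ⟨i, hi⟩ else 0) (by decide) ?_)
    (fun s₃ hF₃ h₃ => Runs.branch (T := 8 + n * 17 + 9) (fun hb => ?_) (fun hb => ?_))))) ?_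
    (fun _ _ h => h)
  · rw [hF₁.nat 0 rfl, hn]
  · intro i _ s' hc hF
    simp only [RExpr.eval, NExpr.eval, hc]
    rw [hF.real src (by simp [sumLoop, forLoop, Prog.writesReal, hs9]), hF.real 4 rfl]
  · rw [hF₂.nat 0 rfl, hF₁.nat 0 rfl, hn]
  · intro i hi s' hc hF
    have hreal : ∀ a, a ≠ 4 → a ≠ 9 → a ≠ 10 → s'.real a = s.real a := fun a h4 h9 h10 => by
      rw [hF.real a (by simp [sumLoop, forLoop, Prog.writesReal, h10]),
        hF₂.real a (by simp [sumLoop, forLoop, Prog.writesReal, h9]),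
        hF₁.real a (by simp [mulVecProg, forLoop, Prog.writesReal, h4])]
    simp only [RExpr.eval, NExpr.eval, hc]
    rw [hg s' hreal ⟨i, hi⟩ hc, hreal 2 (by decide) (by decide) (by decide), dif_pos hi]
    exact congrArg (· * _) (hd ⟨i, hi⟩)
  rotate_left 2
  · simp only [NExpr.cost, RExpr.cost, Test.cost, quotientExpr]
    nlinarith
  all_goals
    have hnum : s₃.real 9 0 = x ⬝ᵥ (A *ᵥ x) := by
      rw [hF₃.real 9 rfl, h₂]
      refine sum_range_eq_of_stores fun i => ?_
      rw [h₁ i, hF₁.real src (by simp [mulVecProg, forLoop, Prog.writesReal, hs4]), hx i]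
    have hden : s₃.real 10 0 = ∑ i, wdeg A i * G i := by
      rw [h₃]
      exact sum_range_eq_of_stores fun i => by simp
    have hreal : ∀ a, a ≠ 4 → a ≠ 9 → a ≠ 10 → s₃.real a = s.real a := fun a h4 h9 h10 => by
      rw [hF₃.real a (by simp [sumLoop, forLoop, Prog.writesReal, h10]),
        hF₂.real a (by simp [sumLoop, forLoop, Prog.writesReal, h9]),
        hF₁.real a (by simp [mulVecProg, forLoop, Prog.writesReal, h4])]
    simp only [Test.holds, quotientExpr, RExpr.eval, NExpr.eval, hnum, hden, Int.cast_zero, zero_sub,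
      hreal r hr4 hr9 hr10] at hb
  · have hL₃ : Loaded n es s₃ := ((hL.frame hF₁).frame hF₂).frame hF₃
    refine Runs.seq (runs_copyProg hsb hL₃ (x := x) ?_) (fun s₄ hF₄ h₄ =>
      Runs.mono (Runs.setReal (Q := fun s' => Stores (s'.real best) x ∧ s'.real r 0 =
        -(x ⬝ᵥ (A *ᵥ x)) / (∑ i, wdeg A i * G i)) ⟨?_, ?_⟩) (by simp [NExpr.cost, RExpr.cost, quotientExpr])
        (fun _ _ h => Or.inl ⟨hb, h⟩))
    · rw [hreal src hs4 hs9 hs10]; exact hx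
    · rwa [State.writeReal_real_of_ne _ _ _ (Ne.symm hrb)]
    · rw [State.writeReal_real_self]
      simp only [quotientExpr, RExpr.eval, NExpr.eval,
        hF₄.real 9 (by simp [copyProg, forLoop, Prog.writesReal, hb9.symm]),
        hF₄.real 10 (by simp [copyProg, forLoop, Prog.writesReal, hb10.symm]), hnum, hden]
      simp
  · refine Runs.mono (Runs.skip (Or.inr ⟨not_lt.mp hb, hreal best hb4 hb9 hb10, ?_⟩)) (by omega)
      (fun _ _ h => h)
    rw [hreal r hr4 hr9 hr10]

/-! ### Preprocessing -/

/-- The input is unchanged, and the degrees and the bounds of the two inner loops are computed. -/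
structure Ready (A : Matrix (Fin n) (Fin n) ℝ) (es : List (Fin n × Fin n × ℝ)) (s : State) :
    Prop where
  loaded : Loaded n es s
  deg : Stores (s.real 2) (wdeg A)
  steps : s.nat 10 0 = 2 * (Nat.clog 2 n * Nat.clog 2 n)
  widths : s.nat 11 0 = 9 * Nat.clog 2 n

theorem Ready.frame {p : Prog} {s s' : State} (h : Ready A es s) (hF : p.Frame s s')
    (h0 : p.writesNat 0 = false := by rfl) (h1 : p.writesNat 1 = false := by rfl)
    (h2 : p.writesNat 2 = false := by rfl) (h3 : p.writesReal 0 = false := by rfl)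
    (h4 : p.writesReal 2 = false := by rfl) (h5 : p.writesNat 10 = false := by rfl)
    (h6 : p.writesNat 11 = false := by rfl) : Ready A es s' :=
  ⟨h.loaded.frame hF h0 h1 h2 h3, (hF.real 2 h4).symm ▸ h.deg, (hF.nat 10 h5).symm ▸ h.steps,
    (hF.nat 11 h6).symm ▸ h.widths⟩

theorem Ready.writeReal {s : State} (h : Ready A es s) {a : ℕ} (i : ℕ) (v : ℝ) (h0 : a ≠ 0)
    (h2 : a ≠ 2) : Ready A es (s.writeReal a i v) :=
  ⟨⟨h.loaded.nat_zero, h.loaded.nat_one, h.loaded.nat_two,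
    (State.writeReal_real_of_ne _ _ _ h0.symm).trans h.loaded.real_zero⟩,
    (State.writeReal_real_of_ne s i v h2.symm).symm ▸ h.deg, h.steps, h.widths⟩

/-- Compute `|A|` times the all-ones vector. -/
def degreeProg : Prog :=
  .seq (absProg 1 0 1)
    (.seq (forLoop 6 0 0 (.setReal 3 (cell 6 0) (.const 1))) (mulVecProg 1 3 2))

theorem runs_degreeProg {s : State} (hA : A.IsSymm) (hdiag : ∀ i, A i i = 0) (hE : IsEdgeList A es)
    (hL : Loaded n es s) :
    Runs degreeProg s (80 * (n + es.length + 1)) (fun s' => Stores (s'.real 2) (wdeg A) ∧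
      ∀ e (he : e < es.length), s'.real 1 e = |es[e].2.2|) := by
  refine Runs.mono (Runs.seq (runs_absProg hL.numEdges (by decide)) fun s₁ hF₁ h₁ =>
    Runs.seq (runs_map (d := 3) (T := 4) (N := n) ?_ (fun _ => 1) rfl rfl (by decide) ?_)
      fun s₂ hF₂ h₂ => Runs.mono (runs_mulVecProg (f := fun w => |w|) (x := fun _ => 1) (by decide)
        (by decide) (by decide) hA hdiag hE ((hL.frame hF₁).frame hF₂) abs_zero ?_ ?_) le_rfl ?_)
      ?_ (fun _ _ h => h)
  · rw [hF₁.nat 0 rfl, hL.numVertices]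
  · intro i _ s' hc _ _
    refine Runs.setReal ?_
    rw [State.writeReal_real_self]
    simp [NExpr.eval, RExpr.eval, hc]
  · intro e he
    rw [hF₂.real 1 rfl, h₁ e he, hL.weight he]
  · intro i
    rw [h₂, if_pos i.2]
  · refine fun s₃ hF₃ h₃ => ⟨fun i => ?_, fun e he => ?_⟩
    · rw [h₃ i]; simp [wdeg]
    · rw [hF₃.real 1 rfl, hF₂.real 1 rfl, h₁ e he, hL.weight he]
  · omega

/-- Compute `K = ⌈log₂ n⌉`, together with `2 K²` and `9 K`. -/
def sizeProg : Prog :=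
  .seq (.setNat 9 (.const 0) (.const 1))
    (forLoop 6 0 0 (.branch (.natLt (cell 9 0) (cell 0 0))
      (.seq (.setNat 9 (.const 0) (.add (cell 9 0) (cell 9 0)))
        (.seq (.setNat 10 (.const 0) (.add (cell 10 0)
            (.add (.add (.add (cell 8 0) (cell 8 0)) (.add (cell 8 0) (cell 8 0))) (.const 2))))
          (.seq (.setNat 11 (.const 0) (.add (cell 11 0) (.const 9)))
            (.setNat 8 (.const 0) (.add (cell 8 0) (.const 1))))))
      .skip))

theorem runs_sizeProg {s : State} (hn : s.nat 0 0 = n) (h8 : s.nat 8 0 = 0) (h10 : s.nat 10 0 = 0)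
    (h11 : s.nat 11 0 = 0) :
    Runs sizeProg s (80 * (n + 1)) (fun s' => s'.nat 10 0 = 2 * (Nat.clog 2 n * Nat.clog 2 n) ∧
      s'.nat 11 0 = 9 * Nat.clog 2 n) := by
  refine Runs.mono (Runs.setNat_seq (T := 8 + n * (11 + 50)) ?_) ?_ (fun _ _ h => h)
  · change Runs _ (s.writeNat 9 0 1) _ _
    refine Runs.mono (runs_forLoop (N := n) (T := 50)
      (by rw [State.writeNat_nat_of_ne _ _ _ (by decide), hn])
      (fun i s' => s'.nat 9 0 = 2 ^ min i (Nat.clog 2 n) ∧ s'.nat 8 0 = min i (Nat.clog 2 n) ∧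
        s'.nat 10 0 = 2 * (min i (Nat.clog 2 n) * min i (Nat.clog 2 n)) ∧
        s'.nat 11 0 = 9 * min i (Nat.clog 2 n)) rfl rfl (by decide) ?_ ?_ ?_) le_rfl ?_
    · intro i s₁ s₂ h _
      rw [h 9 (by decide), h 8 (by decide), h 10 (by decide), h 11 (by decide)]
      exact id
    · rw [State.writeNat_nat_self, State.writeNat_nat_of_ne _ _ _ (by decide),
        State.writeNat_nat_of_ne _ _ _ (by decide), State.writeNat_nat_of_ne _ _ _ (by decide)]
      simp [h8, h10, h11]
    · intro i _ s' hc hF ⟨h9', h8', h10', h11'⟩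
      have hn' : s'.nat 0 0 = n := by
        rw [hF.nat 0 rfl, State.writeNat_nat_of_ne _ _ _ (by decide), hn]
      refine Runs.mono (Runs.branch (T := 45) (fun hb => ?_) (fun hb => ?_)) (by decide) (fun _ _ h => h)
      all_goals
        simp only [Test.holds, NExpr.eval, h9', hn', ← not_le,
          ← Nat.clog_le_iff_le_pow one_lt_two] at hb
      · have h1 : min i (Nat.clog 2 n) = i := by omega
        have h2 : min (i + 1) (Nat.clog 2 n) = i + 1 := by omega
        rw [h1] at h8' h9' h10' h11'
        rw [h2]
        refine Runs.mono (Runs.setNat_seq (Runs.setNat_seq (Runs.setNat_seq (Runs.setNat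
          (Q := fun s' => s'.nat 9 0 = 2 ^ (i + 1) ∧ s'.nat 8 0 = i + 1 ∧
            s'.nat 10 0 = 2 * ((i + 1) * (i + 1)) ∧ s'.nat 11 0 = 9 * (i + 1)) ?_))))
          (by simp [NExpr.cost]) (fun _ _ h => h)
        simp only [NExpr.eval, State.writeNat, Function.update_apply, h9']
        norm_num [Function.update_apply, h8', h9', h10', h11']
        refine ⟨by ring, by ring, by ring⟩
      · have h1 : min (i + 1) (Nat.clog 2 n) = min i (Nat.clog 2 n) := by omega
        rw [h1]
        exact Runs.mono (Runs.skip ⟨h9', h8', h10', h11'⟩) (by decide) (fun _ _ h => h)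
    · rintro s' - ⟨-, -, h10', h11'⟩
      have h1 : min n (Nat.clog 2 n) = Nat.clog 2 n :=
        min_eq_right ((Nat.clog_le_iff_le_pow one_lt_two).mpr Nat.lt_two_pow_self.le)
      rw [h1] at h10' h11'
      exact ⟨h10', h11'⟩
  · simp only [NExpr.cost]; omega


/-! ### Candidates for the rounding -/

/-- The array `8` holds a vector with entries in `[-1, 1]`, and the register `12` its quotient. -/
def HoldsCandidate (A : Matrix (Fin n) (Fin n) ℝ) (s : State) : Prop :=
  ∃ Z : Fin n → ℝ, Stores (s.real 8) Z ∧ (∀ i, |Z i| ≤ 1) ∧ roundingQuotient A Z = s.real 12 0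

theorem HoldsCandidate.congr {s s' : State} (h : HoldsCandidate A s) (h8 : s'.real 8 = s.real 8)
    (h12 : s'.real 12 = s.real 12) : HoldsCandidate A s' := by
  obtain ⟨Z, h1, h2, h3⟩ := h
  exact ⟨Z, h8 ▸ h1, h2, h12 ▸ h3⟩

/-- Replace the candidate in the array `8` by the vector in the array `7` if that is better. -/
def considerProg : Prog := .seq (absProg 0 7 16) (keepBest 7 8 12 (.load 16 (cell 6 0)))

theorem runs_considerProg {s : State} (hA : A.IsSymm) (hdiag : ∀ i, A i i = 0)
    (hE : IsEdgeList A es) (hR : Ready A es s) {z : Fin n → ℝ} (hz : Stores (s.real 7) z)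
    (hz1 : ∀ i, |z i| ≤ 1) (hC : HoldsCandidate A s) :
    Runs considerProg s (160 * (n + es.length + 1)) (fun s' => HoldsCandidate A s' ∧
      s.real 12 0 ≤ s'.real 12 0 ∧ roundingQuotient A z ≤ s'.real 12 0) := by
  refine Runs.mono (Runs.seq (runs_absProg hR.loaded.numVertices (by decide)) fun s₁ hF₁ h₁ =>
    Runs.mono (runs_keepBest (x := z) (G := fun i => |z i|) hA hdiag hE (hR.loaded.frame hF₁)
      (hR.frame hF₁).deg ?_ ?_ (by decide) (by decide) (by decide) (by decide)) le_rfl ?_) ?_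
      (fun _ _ h => h)
  · rw [hF₁.real 7 rfl]; exact hz
  · intro s' hs' i hi
    simp only [RExpr.eval, NExpr.eval, hi]
    rw [hs' 16 (by decide) (by decide) (by decide), h₁ i i.2, hz i]
  · intro s' _ h
    rw [hF₁.real 12 rfl, hF₁.real 8 rfl] at h
    change (_ < roundingQuotient A z ∧ _ ∧ _ = roundingQuotient A z) ∨
      (roundingQuotient A z ≤ _ ∧ _) at h
    rcases h with ⟨hlt, hst, hr⟩ | ⟨hle, hb, hr⟩
    · exact ⟨⟨z, hst, hz1, hr.symm⟩, by rw [hr]; exact hlt.le, hr.ge⟩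
    · obtain ⟨Z, h2, h3, h4⟩ := hC
      exact ⟨⟨Z, hb ▸ h2, h3, h4.trans hr.symm⟩, hr.ge, hle.trans hr.ge⟩
  · omega

/-- The sign vector of an edge with endpoints `u` and `v`. -/
noncomputable def edgeVec (A : Matrix (Fin n) (Fin n) ℝ) (u v : Fin n) : Fin n → ℝ :=
  Function.update (Pi.single u 1) v (0 - A u v / |A u v|)

/-- Both endpoints of the heaviest edge have degree at most `n` times its weight. -/
theorem one_div_le_roundingQuotient_edgeVec (hA : A.IsSymm) (hdiag : ∀ i, A i i = 0) {u v : Fin n}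
    (hne : A u v ≠ 0) (hmax : ∀ i j, |A i j| ≤ |A u v|) :
    1 / (n : ℝ) ≤ roundingQuotient A (edgeVec A u v) := by
  have huv : u ≠ v := fun h => hne (by rw [h, hdiag])
  have hn : (0 : ℝ) < n := by exact_mod_cast u.pos
  have hpos : 0 < |A u v| := abs_pos.mpr hne
  have hdeg : ∀ i, wdeg A i ≤ n * |A u v| := fun i => by
    refine (Finset.sum_le_sum fun j _ => hmax i j).trans_eq ?_
    simp
  have hnum : -(edgeVec A u v ⬝ᵥ (A *ᵥ edgeVec A u v)) = 2 * |A u v| := by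
    have h := lagrangian_update hA hdiag 0 (Pi.single u 1) v (0 - A u v / |A u v|)
    have h1 : lagrangian A 0 (Pi.single u 1) = 0 := by simp [lagrangian, hdiag]
    have h2 : A u v * A u v = |A u v| * |A u v| := (abs_mul_abs_self _).symm
    rw [h1] at h
    simp only [lagrangian, zero_mul, sub_zero, zero_add] at h
    rw [edgeVec, h]
    simp only [Matrix.mulVec_single_one, Matrix.col_apply, hA.apply, Pi.single_eq_of_ne huv.symm]
    rw [mul_zero, sub_zero]
    field_simp
    linarith
  have hsgn : abs ((0 : ℝ) - A u v / |A u v|) = 1 := by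
    rw [zero_sub, abs_neg, abs_div, abs_abs, div_self hpos.ne']
  have hvol : absVolume A (edgeVec A u v) = wdeg A u + wdeg A v := by
    rw [absVolume, Finset.sum_eq_add u v huv (fun i _ hi => ?_) (by simp) (by simp)]
    · simp only [edgeVec, Function.update_self, Function.update_of_ne huv, Pi.single_eq_same, hsgn]
      simp
    · rw [edgeVec, Function.update_of_ne hi.2, Pi.single_eq_of_ne hi.1]; simp
  have hvpos : 0 < wdeg A u + wdeg A v :=
    add_pos_of_pos_of_nonneg (hpos.trans_le (abs_le_wdeg u v)) (wdeg_nonneg v)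
  rw [roundingQuotient, hnum, hvol, div_le_div_iff₀ hn hvpos]
  linarith [hdeg u, hdeg v]

theorem abs_edgeVec_le_one (u v i : Fin n) : |edgeVec A u v i| ≤ 1 := by
  rw [edgeVec, Function.update_apply]
  split_ifs
  · rw [zero_sub, abs_neg, abs_div, abs_abs]; exact div_self_le_one _
  · by_cases h : i = u <;> simp [h]

/-- Find the heaviest edge and consider its sign vector. -/
def heaviestEdgeProg : Prog :=
  .seq (forLoop 6 0 1 (.branch (.realLt (.load 1 (cell 7 0)) (.load 1 (cell 6 0)))
      (.setNat 7 (.const 0) (cell 6 0)) .skip))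
    (.seq (forLoop 6 0 0 (.setReal 7 (cell 6 0) (.const 0)))
      (.seq (.setReal 7 (.load 1 (cell 7 0)) (.const 1))
        (.seq (.setReal 7 (.load 2 (cell 7 0))
          (.sub (.const 0) (.div (.load 0 (cell 7 0)) (.load 1 (cell 7 0)))))
          considerProg)))

theorem runs_heaviestEdgeProg {s : State} (hA : A.IsSymm) (hdiag : ∀ i, A i i = 0)
    (hE : IsEdgeList A es) (hm : 0 < es.length) (hR : Ready A es s)
    (habs : ∀ e (he : e < es.length), s.real 1 e = |es[e].2.2|) (h7 : s.nat 7 0 = 0)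
    (hC : HoldsCandidate A s) :
    Runs heaviestEdgeProg s (250 * (n + es.length + 1)) (fun s' => HoldsCandidate A s' ∧
      1 / (n : ℝ) ≤ s'.real 12 0) := by
  refine Runs.mono (Runs.seq (runs_forLoop (T := 20) hR.loaded.numEdges (fun e s' =>
      s'.nat 7 0 < es.length ∧ ∀ e' < e, s'.real 1 e' ≤ s'.real 1 (s'.nat 7 0)) rfl rfl (by decide)
      ?_ ?_ ?_) fun s₁ hF₁ h₁ =>
    Runs.seq (runs_map (d := 7) (T := 4) (N := n) ?_ (fun _ => 0) rfl rfl (by decide) ?_)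
      fun s₂ hF₂ h₂ => Runs.setReal_seq (Runs.setReal_seq
        (Runs.mono (?_ : Runs considerProg _ (160 * (n + es.length + 1)) (fun s' => HoldsCandidate A s' ∧
      1 / (n : ℝ) ≤ s'.real 12 0)) le_rfl fun _ _ h => h)))
      ?_ (fun _ _ h => h)
  · intro i s₁ s₂ h h'
    rw [h 7 (by decide), h']
    exact id
  · exact ⟨by rwa [h7], by simp⟩
  · intro e he s' hc hF ⟨h1, h2⟩
    refine Runs.mono (Runs.branch (T := 4) (fun hb => ?_) (fun hb => ?_)) (by decide) (fun _ _ h => h)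
    all_goals simp only [Test.holds, RExpr.eval, NExpr.eval, hc] at hb
    · refine Runs.setNat ?_
      simp only [State.writeNat_nat_self, State.writeNat_real, NExpr.eval, hc, Function.update_self]
      refine ⟨he, fun e' he' => ?_⟩
      rcases Nat.lt_succ_iff_lt_or_eq.mp he' with h | rfl
      · exact (h2 e' h).trans hb.le
      · exact le_rfl
    · refine Runs.mono (Runs.skip ⟨h1, fun e' he' => ?_⟩) (by decide) (fun _ _ h => h)
      rcases Nat.lt_succ_iff_lt_or_eq.mp he' with h | rfl
      · exact h2 e' h
      · exact not_lt.mp hb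
  · rw [hF₁.nat 0 rfl, hR.loaded.numVertices]
  · intro i _ s' hc _ _
    refine Runs.setReal ?_
    rw [State.writeReal_real_self]
    simp [NExpr.eval, RExpr.eval, hc]
  · obtain ⟨he, hmax⟩ := h₁
    have hR₂ := (hR.frame hF₁).frame hF₂
    have h72 : s₂.nat 7 0 = s₁.nat 7 0 := by rw [hF₂.nat 7 rfl]
    set e := s₁.nat 7 0
    have habs₁ : ∀ e (he : e < es.length), s₁.real 1 e = |es[e].2.2| := by rwa [hF₁.real 1 rfl]
    obtain ⟨hw, hw0⟩ := hE.2.1 es[e] (List.getElem_mem he)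
    have hmax' : ∀ i j, |A i j| ≤ |A es[e].1 es[e].2.1| := by
      intro i j
      by_cases h0 : A i j = 0
      · simp [h0]
      obtain ⟨e', he', hs⟩ := hE.2.2 i j h0
      obtain ⟨l, hl, rfl⟩ := List.getElem_of_mem he'
      have h3 := hmax l hl
      rw [habs₁ l hl, habs₁ e he, (hE.2.1 _ he').1, hw] at h3
      rcases Sym2.eq_iff.mp hs with ⟨h1, h2⟩ | ⟨h1, h2⟩
      · rwa [h1, h2] at h3
      · rwa [h1, h2, hA.apply] at h3
    refine Runs.mono (runs_considerProg (z := edgeVec A es[e].1 es[e].2.1) hA hdiag hE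
      ((hR₂.writeReal _ _ (by decide) (by decide)).writeReal _ _ (by decide) (by decide)) ?_
      (abs_edgeVec_le_one _ _) (hC.congr ?_ ?_)) le_rfl ?_
    · intro i
      simp only [NExpr.eval, RExpr.eval, State.writeReal_nat, h72, hR₂.loaded.fst he,
          hR₂.loaded.snd he, State.writeReal_real_self]
      rw [State.writeReal_real_of_ne _ _ _ (by decide), State.writeReal_real_of_ne _ _ _ (by decide),
        hR₂.loaded.weight he, hF₂.real 1 rfl, habs₁ e he, hw]
      simp only [edgeVec, Function.update_apply, Fin.val_inj, h₂, Pi.single_apply]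
      simp
    · rw [State.writeReal_real_of_ne _ _ _ (by decide), State.writeReal_real_of_ne _ _ _ (by decide),
        hF₂.real 8 rfl, hF₁.real 8 rfl]
    · rw [State.writeReal_real_of_ne _ _ _ (by decide), State.writeReal_real_of_ne _ _ _ (by decide),
        hF₂.real 12 rfl, hF₁.real 12 rfl]
    · rintro s' - ⟨h3, -, h4⟩
      exact ⟨h3, (one_div_le_roundingQuotient_edgeVec hA hdiag (hw ▸ hw0) hmax').trans h4⟩
  · simp only [NExpr.cost, RExpr.cost]
    omega

/-! ### The power method -/

/-- Run `2 K²` steps of the power method from every vertex, and keep the vector with the largest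
quotient. -/
def powerProg : Prog :=
  forLoop 4 0 0
    (.seq (forLoop 6 0 0 (.setReal 3 (cell 6 0) (.const 0)))
      (.seq (.setReal 3 (cell 4 0) (.const 1))
        (.seq
          (forLoop 5 10 0 (.seq (mulVecProg 0 3 4)
            (forLoop 6 0 0 (.setReal 3 (cell 6 0) (.sub (.load 3 (cell 6 0))
              (.div (.load 4 (cell 6 0)) (.load 2 (cell 6 0))))))))
          (keepBest 3 5 11 (.mul (.load 3 (cell 6 0)) (.load 3 (cell 6 0)))))))

theorem runs_powerIteration {s : State} (hA : A.IsSymm) (hdiag : ∀ i, A i i = 0)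
    (hE : IsEdgeList A es) (hR : Ready A es s) {x : Fin n → ℝ} (hx : Stores (s.real 3) x) {k : ℕ}
    (hk : s.nat 10 0 = k) :
    Runs (forLoop 5 10 0 (.seq (mulVecProg 0 3 4)
      (forLoop 6 0 0 (.setReal 3 (cell 6 0) (.sub (.load 3 (cell 6 0))
        (.div (.load 4 (cell 6 0)) (.load 2 (cell 6 0)))))))) s
      (8 + k * (100 * (n + es.length + 1)))
      (fun s' => Stores (s'.real 3) ((powerStep A ^ k) x)) := by
  refine Runs.mono (runs_forLoop (T := 45 * (n + es.length + 1) + (8 + n * (11 + 14))) hk (fun i s' =>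
    Stores (s'.real 3) ((powerStep A ^ i) x)) rfl rfl (by decide) ?_ ?_ ?_) ?_ (fun _ _ h => h)
  · intro i s₁ s₂ _ h h'; rwa [h]
  · simpa using hx
  · intro i _ s' _ hF hI
    have hR' := hR.frame hF
    refine Runs.seq (runs_mulVecProg_weights (by decide) (by decide) hA hdiag hE hR'.loaded hI)
      fun s₁ hF₁ h₁ => Runs.mono (runs_map (d := 3) (N := n) (T := 14) (hR'.frame hF₁).loaded.numVertices
        (fun l => s₁.real 3 l - s₁.real 4 l / s₁.real 2 l) rfl rfl (by decide) ?_) le_rfl ?_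
    · intro l _ s'' hc hF' h3
      refine Runs.setReal ?_
      rw [State.writeReal_real_self]
      simp only [NExpr.eval, RExpr.eval, hc, h3, hF'.real 4 rfl, hF'.real 2 rfl]
    · intro s'' _ h l
      rw [h, if_pos l.2, h₁ l, (hR'.frame hF₁).deg l, hF₁.real 3 rfl, hI l, pow_succ',
        Module.End.mul_apply]
      rfl
  · gcongr; omega

theorem runs_powerProg {s : State} (hA : A.IsSymm) (hdiag : ∀ i, A i i = 0)
    (hE : IsEdgeList A es) (hR : Ready A es s) {k : ℕ} (hk : s.nat 10 0 = k)
    (h5 : ∀ i, s.real 5 i = 0) (h11 : s.real 11 0 = 0) :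
    Runs powerProg s (8 + n * (200 * (n + es.length + 1) + k * (100 * (n + es.length + 1))))
      (fun s' => ∃ X : Fin n → ℝ, Stores (s'.real 5) X ∧
        ∀ v, gainQuotient A ((powerStep A ^ k) (Pi.single v 1)) ≤ gainQuotient A X) := by
  refine Runs.mono (runs_forLoop
    (T := (8 + n * (11 + 4)) + (4 + ((8 + k * (100 * (n + es.length + 1))) + 120 * (n + es.length + 1))))
    hR.loaded.numVertices (fun i s' => ∃ X : Fin n → ℝ, Stores (s'.real 5) X ∧
      gainQuotient A X = s'.real 11 0 ∧ ∀ v : Fin n, (v : ℕ) < i →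
        gainQuotient A ((powerStep A ^ k) (Pi.single v 1)) ≤ s'.real 11 0)
    rfl rfl (by decide) ?_ ?_ ?_) ?_ ?_
  · intro i s₁ s₂ _ h h'; rwa [h]
  · exact ⟨0, fun i => h5 i, by simp [gainQuotient, h11], by simp⟩
  · intro i hi s' hc hF ⟨X, hX, hq, hmax⟩
    have hR' := hR.frame hF
    refine Runs.seq (runs_map (d := 3) (T := 4) hR'.loaded.numVertices (fun _ => 0) rfl rfl (by decide) ?_)
      fun s₁ hF₁ h₁ => Runs.setReal_seq (Runs.seq (runs_powerIteration (x := Pi.single ⟨i, hi⟩ 1)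
        hA hdiag hE ((hR'.frame hF₁).writeReal (a := 3) _ _ (by decide) (by decide)) ?_ ?_)
        fun s₂ hF₂ h₂ => Runs.mono (runs_keepBest (src := 3) (best := 5) (r := 11)
          (g := .mul (.load 3 (cell 6 0)) (.load 3 (cell 6 0))) (G := fun l =>
          (powerStep A ^ k) (Pi.single ⟨i, hi⟩ 1) l * (powerStep A ^ k) (Pi.single ⟨i, hi⟩ 1) l)
          hA hdiag hE (?_ : Ready A es s₂).loaded (?_ : Ready A es s₂).deg h₂ ?_ (by decide) (by decide)
          (by decide) (by decide)) le_rfl ?_)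
    · intro l _ s'' hc' _ _
      refine Runs.setReal ?_
      rw [State.writeReal_real_self]
      simp [NExpr.eval, RExpr.eval, hc']
    · intro l
      rw [State.writeReal_real_self]
      simp [NExpr.eval, RExpr.eval, hF₁.nat 4 rfl, hc, Function.update_apply, h₁, Pi.single_apply,
        Fin.ext_iff]
    · rw [State.writeReal_nat, hF₁.nat 10 rfl, hF.nat 10 rfl, hk]
    · exact ((hR'.frame hF₁).writeReal _ _ (by decide) (by decide)).frame hF₂
    · exact ((hR'.frame hF₁).writeReal _ _ (by decide) (by decide)).frame hF₂
    · intro s₃ hs₃ l hl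
      simp only [RExpr.eval, NExpr.eval, hl]
      rw [hs₃ 3 (by decide) (by decide) (by decide), h₂ l]
    · intro s₃ _ h
      rw [← dotProduct_degMatrix] at h
      have e11 : s₂.real 11 = s'.real 11 := by
        rw [hF₂.real 11 rfl, State.writeReal_real_of_ne _ _ _ (by decide), hF₁.real 11 rfl]
      have e5 : s₂.real 5 = s'.real 5 := by
        rw [hF₂.real 5 rfl, State.writeReal_real_of_ne _ _ _ (by decide), hF₁.real 5 rfl]
      rw [e11, e5] at h
      change (_ < gainQuotient A _ ∧ _ ∧ _ = gainQuotient A _) ∨ (gainQuotient A _ ≤ _ ∧ _) at h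
      have hlt : ∀ v : Fin n, (v : ℕ) < i + 1 → (v : ℕ) < i ∨ v = ⟨i, hi⟩ := fun v hv =>
        (Nat.lt_succ_iff_lt_or_eq.mp hv).imp_right fun h => Fin.ext h
      rcases h with ⟨h1, h2, h3⟩ | ⟨h1, h2, h3⟩
      · refine ⟨_, h2, h3.symm, fun v hv => ?_⟩
        rw [h3]
        rcases hlt v hv with hv | rfl
        · exact (hmax v hv).trans h1.le
        · exact le_rfl
      · refine ⟨X, h2 ▸ hX, hq.trans h3.symm, fun v hv => ?_⟩
        rw [h3]
        rcases hlt v hv with hv | rfl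
        · exact hmax v hv
        · exact h1
  · exact Nat.add_le_add_left (Nat.mul_le_mul_left n (by omega)) 8
  · rintro s' - ⟨X, hX, hq, hmax⟩
    exact ⟨X, hX, fun v => (hmax v v.2).trans hq.ge⟩

/-! ### The search for a window -/

/-- Consider the window of the vector in the array `5` (with absolute values in the array `6`) whose
lower end is in the register `14`, and whose ratio of the ends is in the register `13`. -/
def windowProg : Prog :=
  .seq (forLoop 6 0 0 (.branch (.realLe (.load 14 (.const 0)) (.load 6 (cell 6 0)))
      (.branch (.realLt (.load 6 (cell 6 0)) (.mul (.load 14 (.const 0)) (.load 13 (.const 0))))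
        (.setReal 7 (cell 6 0) (.div (.load 5 (cell 6 0))
          (.mul (.load 14 (.const 0)) (.load 13 (.const 0)))))
        (.setReal 7 (cell 6 0) (.const 0)))
      (.setReal 7 (cell 6 0) (.const 0))))
    considerProg

theorem runs_windowProg {s : State} (hA : A.IsSymm) (hdiag : ∀ i, A i i = 0)
    (hE : IsEdgeList A es) (hR : Ready A es s) {X : Fin n → ℝ} (h5 : Stores (s.real 5) X)
    (h6 : Stores (s.real 6) fun i => |X i|) (hC : HoldsCandidate A s) {t B : ℝ}
    (ht : s.real 14 0 = t) (hB : s.real 13 0 = B) :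
    Runs windowProg s (210 * (n + es.length + 1)) (fun s' => HoldsCandidate A s' ∧
      s.real 12 0 ≤ s'.real 12 0 ∧ roundingQuotient A (windowVec X t B) ≤ s'.real 12 0) := by
  refine Runs.mono (Runs.seq (runs_map (d := 7) (T := 30) hR.loaded.numVertices
    (fun i => if t ≤ s.real 6 i ∧ s.real 6 i < t * B then s.real 5 i / (t * B) else 0) rfl rfl
    (by decide) ?_) fun s₁ hF₁ h₁ => Runs.mono (runs_considerProg (z := windowVec X t B) hA hdiag hE
      (hR.frame hF₁) ?_ (abs_windowVec_le_one X t B) (hC.congr (hF₁.real 8 rfl) (hF₁.real 12 rfl)))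
      le_rfl ?_) ?_ (fun _ _ h => h)
  · intro i _ s' hc hF _
    have e14 : s'.real 14 0 = t := by rw [hF.real 14 rfl, ht]
    have e13 : s'.real 13 0 = B := by rw [hF.real 13 rfl, hB]
    refine Runs.mono (Runs.branch (T := 24) (fun hb => ?_) (fun hb => ?_)) (by decide) (fun _ _ h => h)
    · refine Runs.mono (Runs.branch (T := 14) (fun hb' => ?_) (fun hb' => ?_)) (by decide)
        (fun _ _ h => h)
      all_goals
        simp only [Test.holds, RExpr.eval, NExpr.eval, hc, hF.real 6 rfl, e14, e13] at hb hb'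
        refine Runs.mono (Runs.setReal ?_) (by simp [NExpr.cost, RExpr.cost]) (fun _ _ h => h)
        rw [State.writeReal_real_self]
        simp only [NExpr.eval, RExpr.eval, hc, hF.real 5 rfl, e14, e13]
      · rw [if_pos ⟨hb, hb'⟩]
      · rw [if_neg fun h => hb' h.2, Int.cast_zero]
    · simp only [Test.holds, RExpr.eval, NExpr.eval, hc, hF.real 6 rfl, e14] at hb
      refine Runs.mono (Runs.setReal ?_) (by simp [NExpr.cost, RExpr.cost]) (fun _ _ h => h)
      rw [State.writeReal_real_self]
      simp only [NExpr.eval, RExpr.eval, hc]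
      rw [if_neg fun h => hb h.1, Int.cast_zero]
  · intro i
    rw [h₁, if_pos i.2, h5 i, h6 i]
    rfl
  · intro s' _ h
    rwa [hF₁.real 12 rfl] at h
  · omega

/-- Consider all windows that have an entry of the vector in the array `5` as their lower or upper
end, and a power of two up to `2 ^ (9 K)` as the ratio of the ends. -/
def searchProg : Prog :=
  .seq (absProg 0 5 6)
    (forLoop 4 0 0
      (.seq (.setReal 13 (.const 0) (.const 1))
        (forLoop 5 11 0
          (.seq (.setReal 13 (.const 0) (.add (.load 13 (.const 0)) (.load 13 (.const 0))))
            (.seq (.setReal 14 (.const 0) (.load 6 (cell 4 0)))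
              (.seq windowProg
                (.seq (.setReal 14 (.const 0) (.div (.load 6 (cell 4 0)) (.load 13 (.const 0))))
                  windowProg)))))))

theorem runs_searchProg {s : State} (hA : A.IsSymm) (hdiag : ∀ i, A i i = 0)
    (hE : IsEdgeList A es) (hR : Ready A es s) {X : Fin n → ℝ} (hX : Stores (s.real 5) X)
    (hC : HoldsCandidate A s) {w : ℕ} (hw : s.nat 11 0 = w) :
    Runs searchProg s (16 + 24 * n + n * (23 + w * (500 * (n + es.length + 1))))
      (fun s' => HoldsCandidate A s' ∧ s.real 12 0 ≤ s'.real 12 0 ∧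
        ∀ v : Fin n, ∀ l, 1 ≤ l → l ≤ w → ∀ t, t = |X v| ∨ t = |X v| / 2 ^ l →
          roundingQuotient A (windowVec X t (2 ^ l)) ≤ s'.real 12 0) := by
  refine Runs.mono (Runs.seq (runs_absProg hR.loaded.numVertices (by decide)) fun s₁ hF₁ h₁ =>
    Runs.mono (runs_forLoop (T := 3 + (8 + w * (11 + (460 * (n + es.length + 1)))))
      (hR.frame hF₁).loaded.numVertices (fun i s' => HoldsCandidate A s' ∧
        s₁.real 12 0 ≤ s'.real 12 0 ∧ ∀ v : Fin n, (v : ℕ) < i → ∀ l, 1 ≤ l → l ≤ w →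
        ∀ t, t = |X v| ∨ t = |X v| / 2 ^ l →
          roundingQuotient A (windowVec X t (2 ^ l)) ≤ s'.real 12 0)
      rfl rfl (by decide) ?_ ?_ ?_) le_rfl ?_) ?_ (fun _ _ h => h)
  · rintro i s s' _ h ⟨h1, h2⟩
    exact ⟨h1.congr (by rw [h]) (by rw [h]), by rwa [h]⟩
  · exact ⟨hC.congr (hF₁.real 8 rfl) (hF₁.real 12 rfl), le_rfl, by simp⟩
  · intro i hi s₂ hc hF₂ ⟨hC₂, hle₂, hall₂⟩
    refine Runs.setReal_seq ?_
    set s₃ := s₂.writeReal 13 (NExpr.eval s₂ (.const 0)) (RExpr.eval s₂ (.const 1)) with hs₃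
    have hR₃ : Ready A es s₃ := ((hR.frame hF₁).frame hF₂).writeReal _ _ (by decide) (by decide)
    have hr₃ : ∀ b ≠ 13, s₃.real b = s₂.real b := fun b hb => State.writeReal_real_of_ne _ _ _ hb
    have h13 : s₃.real 13 0 = 1 := by
      rw [hs₃, State.writeReal_real_self]; simp [NExpr.eval, RExpr.eval]
    have hX₃ : Stores (s₃.real 5) X := by
      rw [hr₃ 5 (by decide), hF₂.real 5 rfl, hF₁.real 5 rfl]; exact hX
    have hX₃' : Stores (s₃.real 6) fun i => |X i| := fun l => by
      rw [hr₃ 6 (by decide), hF₂.real 6 rfl, h₁ l l.2, hX l]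
    have hc₃ : s₃.nat 4 0 = i := hc
    refine Runs.mono (runs_forLoop (T := 460 * (n + es.length + 1)) (N := w) ?_ (fun l s' =>
      HoldsCandidate A s' ∧ s₂.real 12 0 ≤ s'.real 12 0 ∧ s'.real 13 0 = 2 ^ l ∧
        ∀ l', 1 ≤ l' → l' ≤ l → ∀ t, t = |X ⟨i, hi⟩| ∨ t = |X ⟨i, hi⟩| / 2 ^ l' →
          roundingQuotient A (windowVec X t (2 ^ l')) ≤ s'.real 12 0) rfl rfl (by decide) ?_ ?_ ?_)
      le_rfl ?_
    · change s₂.nat 11 0 = w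
      rw [hF₂.nat 11 rfl, hF₁.nat 11 rfl, hw]
    · rintro i s s' _ h ⟨h1, h2⟩
      exact ⟨h1.congr (by rw [h]) (by rw [h]), by rwa [h]⟩
    · refine ⟨hC₂.congr (hr₃ _ (by decide)) (hr₃ _ (by decide)), ?_, by simp [h13], fun l' h1 h0 => by omega⟩
      rw [hr₃ 12 (by decide)]
    · intro l hl s₄ _ hF₄ ⟨hC₄, hle₄, h13₄, hall₄⟩
      refine Runs.mono (Runs.setReal_seq (Runs.setReal_seq (T := 210 * (n + es.length + 1) +
        (8 + 210 * (n + es.length + 1))) ?_)) (by simp only [NExpr.cost, RExpr.cost]; omega)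
        (fun _ _ h => h)
      set s₅ := (s₄.writeReal 13 (NExpr.eval s₄ (.const 0)) (RExpr.eval s₄
        (.add (.load 13 (.const 0)) (.load 13 (.const 0))))) with hs₅
      set s₆ := s₅.writeReal 14 (NExpr.eval s₅ (.const 0)) (RExpr.eval s₅ (.load 6 (cell 4 0))) with hs₆
      have hR₆ : Ready A es s₆ := ((hR₃.frame hF₄).writeReal _ _ (by decide) (by decide)).writeReal _ _
        (by decide) (by decide)
      have hr₆ : ∀ b, b ≠ 13 → b ≠ 14 → s₆.real b = s₄.real b := fun b hb hb' => by
        rw [hs₆, State.writeReal_real_of_ne _ _ _ hb', hs₅, State.writeReal_real_of_ne _ _ _ hb]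
      have h13₆ : s₆.real 13 0 = 2 ^ (l + 1) := by
        rw [hs₆, State.writeReal_real_of_ne _ _ _ (by decide), hs₅, State.writeReal_real_self]
        simp [NExpr.eval, RExpr.eval, h13₄, pow_succ, mul_two]
      have hX₆ : Stores (s₆.real 5) X := by
        rw [hr₆ 5 (by decide) (by decide), hF₄.real 5 rfl]; exact hX₃
      have hX₆' : Stores (s₆.real 6) fun i => |X i| := by
        rw [hr₆ 6 (by decide) (by decide), hF₄.real 6 rfl]; exact hX₃'
      have hc₆ : s₆.nat 4 0 = i := by
        change s₄.nat 4 0 = i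
        rw [hF₄.nat 4 rfl, hc₃]
      have h14₆ : s₆.real 14 0 = |X ⟨i, hi⟩| := by
        rw [hs₆, State.writeReal_real_self]
        change Function.update (s₅.real 14) 0 (s₅.real 6 (s₆.nat 4 0)) 0 = _
        rw [Function.update_self, hc₆]
        have h6 := hX₆' ⟨i, hi⟩
        rwa [hs₆, State.writeReal_real_of_ne _ _ _ (by decide)] at h6
      refine Runs.seq (runs_windowProg hA hdiag hE hR₆ hX₆ hX₆' (hC₄.congr (hr₆ _ (by decide) (by decide))
        (hr₆ _ (by decide) (by decide))) h14₆ h13₆) fun s₇ hF₇ ⟨hC₇, hle₇, hq₇⟩ => ?_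
      refine Runs.mono (Runs.setReal_seq (Runs.mono (runs_windowProg (X := X) (B := 2 ^ (l + 1))
        (t := |X ⟨i, hi⟩| / 2 ^ (l + 1)) hA hdiag hE
        ((hR₆.frame hF₇).writeReal _ _ (by decide) (by decide)) ?_ ?_
        (hC₇.congr ?_ ?_) ?_ ?_) le_rfl ?_)) (by simp [NExpr.cost, RExpr.cost]) (fun _ _ h => h)
      · rw [State.writeReal_real_of_ne _ _ _ (by decide), hF₇.real 5 rfl]; exact hX₆
      · rw [State.writeReal_real_of_ne _ _ _ (by decide), hF₇.real 6 rfl]; exact hX₆'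
      · rw [State.writeReal_real_of_ne _ _ _ (by decide)]
      · rw [State.writeReal_real_of_ne _ _ _ (by decide)]
      · rw [State.writeReal_real_self]
        simp only [NExpr.eval, RExpr.eval, Function.update_self, hF₇.nat 4 rfl, hF₇.real 6 rfl,
          hF₇.real 13 rfl, hc₆, h13₆]
        rw [hX₆' ⟨i, hi⟩]
      · rw [State.writeReal_real_of_ne _ _ _ (by decide), hF₇.real 13 rfl, h13₆]
      · intro s₈ hF₈ ⟨hC₈, hle₈, hq₈⟩
        rw [State.writeReal_real_of_ne _ _ _ (by decide)] at hle₈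
        rw [hr₆ 12 (by decide) (by decide)] at hle₇
        refine ⟨hC₈, hle₄.trans (hle₇.trans hle₈), ?_, fun l' h1 h2 t ht => ?_⟩
        · rw [hF₈.real 13 rfl, State.writeReal_real_of_ne _ _ _ (by decide), hF₇.real 13 rfl, h13₆]
        · rcases Nat.le_succ_iff.mp h2 with h | rfl
          · exact (hall₄ l' h1 h t ht).trans (hle₇.trans hle₈)
          · rcases ht with rfl | rfl
            · exact hq₇.trans hle₈
            · exact hq₈
    · intro s' _ ⟨h1, h2, _, h3⟩
      refine ⟨h1, hle₂.trans h2, fun v hv l hl hl' t ht => ?_⟩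
      rcases Nat.lt_succ_iff_lt_or_eq.mp hv with h | h
      · exact (hall₂ v h l hl hl' t ht).trans h2
      · obtain rfl : v = ⟨i, hi⟩ := Fin.ext h
        exact h3 l hl hl' t ht
  · intro s' _ ⟨h1, h2, h3⟩
    exact ⟨h1, by rwa [hF₁.real 12 rfl] at h2, fun v => h3 v v.2⟩
  · have h : n * (11 + (3 + (8 + w * (11 + 460 * (n + es.length + 1))))) ≤
        n * (23 + w * (500 * (n + es.length + 1))) := by
      refine Nat.mul_le_mul_left n ?_
      have : w * (11 + 460 * (n + es.length + 1)) ≤ w * (500 * (n + es.length + 1)) := by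
        exact Nat.mul_le_mul_left w (by omega)
      omega
    omega

/-! ### The rounding pass -/

/-- Round the vector in the array `8` one coordinate after the other, so that the Lagrangian with half
of the quotient in the register `12` does not decrease, and write the labels to the output array. -/
def roundProg : Prog :=
  forLoop 4 0 0
    (.seq (mulVecProg 0 8 4)
      (.branch (.realLt (.mul (.div (.load 12 (.const 0)) (.const 2)) (.load 2 (cell 4 0)))
          (.mul (.const 2) (.load 4 (cell 4 0))))
        (.seq (.setReal 8 (cell 4 0) (.const (-1))) (.setNat 3 (cell 4 0) (.const 1)))
        (.branch (.realLt (.mul (.div (.load 12 (.const 0)) (.const 2)) (.load 2 (cell 4 0)))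
            (.sub (.const 0) (.mul (.const 2) (.load 4 (cell 4 0)))))
          (.seq (.setReal 8 (cell 4 0) (.const 1)) (.setNat 3 (cell 4 0) (.const 2)))
          (.seq (.setReal 8 (cell 4 0) (.const 0)) (.setNat 3 (cell 4 0) (.const 0))))))

/-- The label of a vertex in the output, as a function of its value. -/
def IsLabel (y : ℝ) (l : ℕ) : Prop := (y = -1 ∧ l = 1) ∨ (y = 1 ∧ l = 2) ∨ (y = 0 ∧ l = 0)

theorem runs_roundProg {s : State} (hA : A.IsSymm) (hdiag : ∀ i, A i i = 0)
    (hE : IsEdgeList A es) (hR : Ready A es s) {Z : Fin n → ℝ} (hZ : Stores (s.real 8) Z)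
    (hZ1 : ∀ i, |Z i| ≤ 1) {ρ : ℝ} (hρ : s.real 12 0 = ρ) (hρ0 : 0 ≤ ρ) :
    Runs roundProg s (8 + n * (120 * (n + es.length + 1))) (fun s' => ∃ y : Fin n → ℝ,
      lagrangian A (ρ / 2) Z ≤ lagrangian A (ρ / 2) y ∧ ∀ i : Fin n, IsLabel (y i) (s'.nat 3 i)) := by
  refine Runs.mono (runs_forLoop (T := 45 * (n + es.length + 1) + 60) hR.loaded.numVertices
    (fun i s' => ∃ y : Fin n → ℝ, Stores (s'.real 8) y ∧ (∀ i, |y i| ≤ 1) ∧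
      lagrangian A (ρ / 2) Z ≤ lagrangian A (ρ / 2) y ∧
      ∀ v : Fin n, (v : ℕ) < i → IsLabel (y v) (s'.nat 3 v)) rfl rfl (by decide) ?_ ?_ ?_) ?_ ?_
  · rintro i s₁ s₂ h h' ⟨y, h1, h2, h3, h4⟩
    exact ⟨y, by rwa [h'], h2, h3, by rwa [h 3 (by decide)]⟩
  · exact ⟨Z, hZ, hZ1, le_rfl, by simp⟩
  · intro i hi s₁ hc hF₁ ⟨y, hy, hy1, hyL, hlab⟩
    have hR₁ := hR.frame hF₁
    refine Runs.seq (runs_mulVecProg_weights (by decide) (by decide) hA hdiag hE hR₁.loaded hy)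
      fun s₂ hF₂ h₂ => ?_
    have hc₂ : s₂.nat 4 0 = i := by rw [hF₂.nat 4 rfl, hc]
    have h12 : s₂.real 12 0 = ρ := by rw [hF₂.real 12 rfl, hF₁.real 12 rfl, hρ]
    have h4 : s₂.real 4 i = (A *ᵥ y) ⟨i, hi⟩ := h₂ ⟨i, hi⟩
    have h2 : s₂.real 2 i = wdeg A ⟨i, hi⟩ := (hR₁.frame hF₂).deg ⟨i, hi⟩
    -- all three cases assign a value and the corresponding label
    have assign : ∀ (a : ℤ) (l : ℕ), IsLabel a l → |(a : ℝ)| ≤ 1 →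
        lagrangian A (ρ / 2) y ≤ lagrangian A (ρ / 2) (Function.update y ⟨i, hi⟩ a) →
        Runs (.seq (.setReal 8 (cell 4 0) (.const a)) (.setNat 3 (cell 4 0) (.const l))) s₂ 8
          (fun s' => ∃ y : Fin n → ℝ, Stores (s'.real 8) y ∧ (∀ i, |y i| ≤ 1) ∧
            lagrangian A (ρ / 2) Z ≤ lagrangian A (ρ / 2) y ∧
            ∀ v : Fin n, (v : ℕ) < i + 1 → IsLabel (y v) (s'.nat 3 v)) := by
      intro a l hal ha1 hle
      refine Runs.mono (Runs.setReal_seq (Runs.setNat ⟨Function.update y ⟨i, hi⟩ a, ?_, ?_,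
        hyL.trans hle, ?_⟩)) (by simp [NExpr.cost, RExpr.cost]) (fun _ _ h => h)
      · intro v
        rw [State.writeNat_real, State.writeReal_real_self]
        simp only [NExpr.eval, RExpr.eval, hc₂, Function.update_apply, Fin.ext_iff]
        rw [hF₂.real 8 rfl, hy v]
      · intro v
        rw [Function.update_apply]
        split_ifs
        exacts [ha1, hy1 v]
      · intro v hv
        rw [State.writeNat_nat_self]
        simp only [NExpr.eval, State.writeReal_nat, hc₂, Function.update_apply, Fin.ext_iff]
        split_ifs with h
        · exact hal
        · rw [hF₂.nat 3 rfl]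
          exact hlab v (by omega)
    have h0 : 0 ≤ ρ / 2 := by positivity
    refine Runs.mono (Runs.branch (T := 40) (fun hb => ?_) (fun hb => Runs.mono (Runs.branch (T := 8)
      (fun hb' => ?_) (fun hb' => ?_)) (by decide) (fun _ _ h => h))) (by decide) (fun _ _ h => h)
    all_goals
      simp only [Test.holds, RExpr.eval, NExpr.eval, hc₂, h12, h4, h2, Int.cast_ofNat, Int.cast_zero,
        zero_sub, not_lt] at *
    · refine Runs.mono (assign (-1) 1 (.inl ⟨by norm_num, rfl⟩) (by norm_num) ?_) (by omega)
        (fun _ _ h => h)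
      rw [Int.cast_neg, Int.cast_one]
      exact lagrangian_le_update_neg_one hA hdiag (hy1 _) hb h0
    · refine assign 1 2 (.inr (.inl ⟨by norm_num, rfl⟩)) (by norm_num) ?_
      rw [Int.cast_one]
      exact lagrangian_le_update_one hA hdiag (hy1 _) hb' h0
    · refine assign 0 0 (.inr (.inr ⟨by norm_num, rfl⟩)) (by norm_num) ?_
      rw [Int.cast_zero]
      exact lagrangian_le_update_zero hA hdiag hb hb'
  · gcongr
    omega
  · rintro s' - ⟨y, -, -, h3, h4⟩
    exact ⟨y, h3, fun v => h4 v v.2⟩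

end RealRAM

/-! ### Correctness and running time of the algorithm -/

namespace RealRAM

variable {n : ℕ} {es : List (Fin n × Fin n × ℝ)} {A : Matrix (Fin n) (Fin n) ℝ}

/-- The whole algorithm. -/
def gainProg : Prog :=
  .seq degreeProg (.seq sizeProg (.seq heaviestEdgeProg (.seq powerProg (.seq searchProg roundProg))))

/-- What the program guarantees: the array `8` before the rounding pass holds `Z`, with quotient `ρ`,
which `y` rounds; the power method ends with `X`. -/
theorem runs_gainProg (hA : A.IsSymm) (hdiag : ∀ i, A i i = 0) (hE : IsEdgeList A es)
    (hm : 0 < es.length) (hn : 2 ≤ n) :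
    Runs gainProg (inputState n es)
      (12000 * (n * (n + es.length) * (Nat.clog 2 n * Nat.clog 2 n))) (fun s' =>
      ∃ (X Z y : Fin n → ℝ) (ρ : ℝ),
        (∀ v, gainQuotient A ((powerStep A ^ (2 * (Nat.clog 2 n * Nat.clog 2 n))) (Pi.single v 1)) ≤
          gainQuotient A X) ∧
        (∀ v : Fin n, ∀ l, 1 ≤ l → l ≤ 9 * Nat.clog 2 n → ∀ t, t = |X v| ∨ t = |X v| / 2 ^ l →
          roundingQuotient A (windowVec X t (2 ^ l)) ≤ ρ) ∧
        1 / (n : ℝ) ≤ ρ ∧ roundingQuotient A Z = ρ ∧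
        lagrangian A (ρ / 2) Z ≤ lagrangian A (ρ / 2) y ∧ ∀ i : Fin n, IsLabel (y i) (s'.nat 3 i)) := by
  have hL : Loaded n es (inputState n es) := ⟨rfl, rfl, rfl, rfl⟩
  refine Runs.mono (Runs.seq (runs_degreeProg hA hdiag hE hL) fun s₁ hF₁ ⟨hdeg₁, habs₁⟩ =>
    Runs.seq (runs_sizeProg (hL.frame hF₁).numVertices
      (by rw [hF₁.nat 8 rfl]; rfl) (by rw [hF₁.nat 10 rfl]; rfl) (by rw [hF₁.nat 11 rfl]; rfl))
      fun s₂ hF₂ ⟨hk₂, hw₂⟩ => ?_) (T := 80 * (n + es.length + 1) + (80 * (n + 1) +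
        (250 * (n + es.length + 1) + ((8 + n * (200 * (n + es.length + 1) +
          2 * (Nat.clog 2 n * Nat.clog 2 n) * (100 * (n + es.length + 1)))) +
        ((16 + 24 * n + n * (23 + 9 * Nat.clog 2 n * (500 * (n + es.length + 1)))) +
        (8 + n * (120 * (n + es.length + 1)))))))) ?_ (fun _ _ h => h)
  · have hR₂ : Ready A es s₂ := ⟨(hL.frame hF₁).frame hF₂, by rw [hF₂.real 2 rfl]; exact hdeg₁, hk₂, hw₂⟩
    refine Runs.seq (runs_heaviestEdgeProg hA hdiag hE hm hR₂ ?_ ?_ ⟨0, ?_, ?_, ?_⟩)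
      fun s₃ hF₃ ⟨hC₃, hq₃⟩ => ?_
    · rwa [hF₂.real 1 rfl]
    · rw [hF₂.nat 7 rfl, hF₁.nat 7 rfl]; rfl
    · intro i
      rw [hF₂.real 8 rfl, hF₁.real 8 rfl]; rfl
    · simp
    · rw [hF₂.real 12 rfl, hF₁.real 12 rfl]
      simp [roundingQuotient, inputState]
    have hR₃ := hR₂.frame hF₃
    refine Runs.seq (runs_powerProg hA hdiag hE hR₃ hR₃.steps ?_ ?_) fun s₄ hF₄ ⟨X, hX, hmax⟩ => ?_
    · intro i
      rw [hF₃.real 5 rfl, hF₂.real 5 rfl, hF₁.real 5 rfl]; rfl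
    · rw [hF₃.real 11 rfl, hF₂.real 11 rfl, hF₁.real 11 rfl]; rfl
    have hR₄ := hR₃.frame hF₄
    refine Runs.seq (runs_searchProg hA hdiag hE hR₄ hX (hC₃.congr (hF₄.real 8 rfl) (hF₄.real 12 rfl))
      hR₄.widths) fun s₅ hF₅ ⟨⟨Z, hZ, hZ1, hZρ⟩, hle₅, hall₅⟩ => ?_
    rw [hF₄.real 12 rfl] at hle₅
    have hρ : 1 / (n : ℝ) ≤ s₅.real 12 0 := hq₃.trans hle₅
    refine Runs.mono (runs_roundProg hA hdiag hE (hR₄.frame hF₅) hZ hZ1 rfl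
      (le_trans (by positivity) hρ)) le_rfl ?_
    rintro s₆ - ⟨y, hy, hlab⟩
    exact ⟨X, Z, y, s₅.real 12 0, hmax, hall₅, hρ, hZρ, hy, hlab⟩
  · have hK : 0 < Nat.clog 2 n := Nat.clog_pos one_lt_two hn
    generalize Nat.clog 2 n = K at hK
    generalize es.length = m
    -- every term is at most a constant times `n (n + m) K²`
    have h1 : n + m + 1 ≤ 2 * (n + m) := by omega
    have h2 : n * (n + m + 1) ≤ 2 * (n * (n + m)) := by nlinarith
    have h3 : n + m ≤ n * (n + m) := Nat.le_mul_of_pos_left _ (by omega)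
    have h4 : K ≤ K * K := Nat.le_mul_self K
    have h5 : n * (n + m) ≤ n * (n + m) * (K * K) := Nat.le_mul_of_pos_right _ (by positivity)
    have h6 : n * (n + m + 1) * (K * K) ≤ 2 * (n * (n + m) * (K * K)) := by
      rw [← mul_assoc 2]; exact Nat.mul_le_mul_right _ h2
    have h7 : n * (n + m + 1) * K ≤ n * (n + m + 1) * (K * K) := Nat.mul_le_mul_left _ h4
    have e1 : n * (200 * (n + m + 1) + 2 * (K * K) * (100 * (n + m + 1))) =
        200 * (n * (n + m + 1)) + 200 * (n * (n + m + 1) * (K * K)) := by ring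
    have e2 : n * (23 + 9 * K * (500 * (n + m + 1))) = 23 * n + 4500 * (n * (n + m + 1) * K) := by ring
    have e3 : n * (120 * (n + m + 1)) = 120 * (n * (n + m + 1)) := by ring
    rw [e1, e2, e3]
    omega

end RealRAM

/-- With `4 K²` factors, where `2 ^ K ≥ n`, the growth rate `1 + ε / 3` of the power method makes up for
the loss of a factor `n`, unless `ε` is less than `1 / K`. -/
theorem natCast_lt_pow_clog {n : ℕ} (hn : 2 ≤ n) {ε : ℝ} (hε : 1 ≤ ε * Nat.clog 2 n) :
    (n : ℝ) < (1 + ε / 3) ^ (2 * (2 * (Nat.clog 2 n * Nat.clog 2 n))) := by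
  have hle : n ≤ 2 ^ Nat.clog 2 n := Nat.le_pow_clog one_lt_two n
  have hK : 0 < Nat.clog 2 n := Nat.clog_pos one_lt_two hn
  set K := Nat.clog 2 n
  have hK' : (0 : ℝ) < K := by exact_mod_cast hK
  have hε0 : 0 < ε := by
    by_contra! h
    nlinarith
  have h1 : (2 : ℝ) ≤ (1 + ε / 3) ^ (3 * K) := by
    have h := one_add_mul_le_pow (a := ε / 3) (by linarith) (3 * K)
    refine le_trans ?_ h
    push_cast
    nlinarith
  calc (n : ℝ) ≤ 2 ^ K := by exact_mod_cast hle
    _ ≤ ((1 + ε / 3) ^ (3 * K)) ^ K := by gcongr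
    _ = (1 + ε / 3) ^ (3 * K * K) := (pow_mul _ _ _).symm
    _ < (1 + ε / 3) ^ (2 * (2 * (K * K))) := by
      refine pow_lt_pow_right₀ (by linarith) ?_
      have : 0 < K * K := by positivity
      rw [mul_assoc]; omega

theorem clog_le_three_mul_log {n : ℕ} (hn : 2 ≤ n) : (Nat.clog 2 n : ℝ) ≤ 3 * Real.log n := by
  have hK : 0 < Nat.clog 2 n := Nat.clog_pos one_lt_two hn
  have hlt := Nat.pow_pred_clog_lt_self one_lt_two (show 1 < n by omega)
  set K := Nat.clog 2 n
  have hn' : (2 : ℝ) ≤ n := by exact_mod_cast hn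
  have h1 : Real.log 2 ≤ Real.log n := Real.log_le_log (by norm_num) hn'
  have h2 : ((K - 1 : ℕ) : ℝ) * Real.log 2 ≤ Real.log n := by
    rw [← Real.log_pow]
    exact Real.log_le_log (by positivity) (by exact_mod_cast hlt.le)
  have h3 : ((K - 1 : ℕ) : ℝ) = K - 1 := by rw [Nat.cast_sub hK]; simp
  rw [h3] at h2
  have h4 := Real.log_two_gt_d9
  have h5 : (0 : ℝ) < K := by exact_mod_cast hK
  nlinarith

/-- For `ε < 1 / K` the heaviest edge is good enough. -/
theorem exp_le_of_inv_le {n : ℕ} {ε ρ : ℝ} (hε : 0 < ε) (hε1 : ε ≤ 1) (hn : 2 ≤ n)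
    (h : ε * Nat.clog 2 n < 1) (hρ : 1 / (n : ℝ) ≤ ρ) : Real.exp (-17 / ε) ≤ ρ / 2 := by
  have hle : n ≤ 2 ^ Nat.clog 2 n := Nat.le_pow_clog one_lt_two n
  set K := Nat.clog 2 n
  have h0 : (0 : ℝ) < n := by exact_mod_cast (by omega : 0 < n)
  have hK : (K : ℝ) ≤ 1 / ε := by rw [le_div_iff₀ hε]; linarith
  have h1 : 1 ≤ 1 / ε := by rwa [le_div_iff₀ hε, one_mul]
  have h2 : (2 : ℝ) ≤ Real.exp 1 := by linarith [Real.add_one_le_exp 1]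
  have h3 : 2 * (n : ℝ) ≤ Real.exp (17 / ε) := by
    calc 2 * (n : ℝ) ≤ 2 * 2 ^ K := by gcongr; exact_mod_cast hle
      _ ≤ Real.exp 1 * Real.exp 1 ^ K := by gcongr
      _ = Real.exp (1 + K) := by rw [← Real.exp_nat_mul, mul_one, Real.exp_add]
      _ ≤ Real.exp (17 / ε) := by
        gcongr
        rw [show 17 / ε = 17 * (1 / ε) by ring]
        linarith
  rw [neg_div, Real.exp_neg]
  calc (Real.exp (17 / ε))⁻¹ ≤ (2 * (n : ℝ))⁻¹ := by gcongr
    _ = 1 / n / 2 := by field_simp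
    _ ≤ ρ / 2 := by gcongr

theorem exp_le_of_div_two_pow_le {ε ρ : ℝ} (hε : 0 < ε) (hε1 : ε ≤ 1) {L : ℕ}
    (hL : (L : ℝ) ≤ 8 / ε + 1) (hρ : ε / 2 / 2 / 2 ^ L ≤ ρ) : Real.exp (-17 / ε) ≤ ρ / 2 := by
  have h1 : 1 ≤ 1 / ε := by rwa [le_div_iff₀ hε, one_mul]
  have h2 : (2 : ℝ) ≤ Real.exp 1 := by linarith [Real.add_one_le_exp 1]
  have h3 : 8 / ε * 2 ^ L ≤ Real.exp (17 / ε) := by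
    calc 8 / ε * 2 ^ L ≤ Real.exp (8 / ε) * Real.exp 1 ^ L := by
          gcongr
          linarith [Real.add_one_le_exp (8 / ε)]
      _ = Real.exp (8 / ε + L) := by rw [← Real.exp_nat_mul, mul_one, Real.exp_add]
      _ ≤ Real.exp (17 / ε) := by
        gcongr
        rw [show 17 / ε = 8 / ε + 8 / ε + 1 / ε by ring]
        have : 8 / ε = 8 * (1 / ε) := by ring
        linarith
  rw [neg_div, Real.exp_neg]
  calc (Real.exp (17 / ε))⁻¹ ≤ (8 / ε * 2 ^ L)⁻¹ := by gcongr
    _ = ε / 2 / 2 / 2 ^ L / 2 := by field_simp; norm_num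
    _ ≤ ρ / 2 := by gcongr

theorem cutVec_filter {n : ℕ} {y : Fin n → ℝ} (hy : ∀ i, y i = -1 ∨ y i = 1 ∨ y i = 0) :
    cutVec (Finset.univ.filter (y · = -1)) (Finset.univ.filter (y · = 1)) = y := by
  ext i
  rcases hy i with h | h | h <;> norm_num [cutVec, h]

theorem volumeOf_filter {n : ℕ} {A : Matrix (Fin n) (Fin n) ℝ} {y : Fin n → ℝ}
    (hy : ∀ i, y i = -1 ∨ y i = 1 ∨ y i = 0) :
    volumeOf A (Finset.univ.filter (y · = -1) ∪ Finset.univ.filter (y · = 1)) =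
      y ⬝ᵥ (degMatrix A *ᵥ y) := by
  rw [volumeOf, ← Finset.filter_or, Finset.sum_filter, dotProduct_degMatrix]
  refine Finset.sum_congr rfl fun i _ => ?_
  rcases hy i with h | h | h <;> norm_num [h]

theorem theorem11 :
    ∃ (P : RealRAM.Prog) (c C : ℝ) (k : ℕ), 0 < c ∧ 0 < C ∧
      ∀ (n : ℕ) (A : Matrix (Fin n) (Fin n) ℝ), A.IsSymm → (∀ i, A i i = 0) →
      ∀ es : List (Fin n × Fin n × ℝ), IsEdgeList A es →
      ∀ ε : ℝ, 0 < ε → ε ≤ gainRatio A →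
        ∃ (s : RealRAM.State) (t : ℕ),
          RealRAM.Exec P (RealRAM.inputState n es) s t ∧
          (t : ℝ) ≤ C * ((n : ℝ) * ((n : ℝ) + (es.length : ℝ))) * Real.log (n : ℝ) ^ k ∧
          ∃ L R : Finset (Fin n), Disjoint L R ∧ RealRAM.Outputs s L R ∧
            0 < volumeOf A (L ∪ R) ∧ Real.exp (-c / ε) ≤ gain A L R := by
  refine ⟨RealRAM.gainProg, 17, 108000, 2, by norm_num, by norm_num,
    fun n A hA hdiag es hE ε hε hγ => ?_⟩
  obtain ⟨y₀, hy₀⟩ := exists_eq_ciSup_of_finite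
    (f := fun y : Fin n → SignType => gainQuotient A (fun i => (y i : ℝ)))
  have hgain : ε ≤ gainQuotient A (fun i => (y₀ i : ℝ)) := hγ.trans hy₀.ge
  have hε1 : ε ≤ 1 := hgain.trans (gainQuotient_le_one hA _)
  -- a graph with a positive gain ratio has an edge
  obtain ⟨i, j, hij⟩ : ∃ i j, A i j ≠ 0 := by
    by_contra! h
    obtain rfl : A = 0 := by ext i j; exact h i j
    simp [gainQuotient] at hgain
    linarith
  have hn : 2 ≤ n := by
    have hne : (i : ℕ) ≠ j := fun h => hij (by rw [Fin.ext h, hdiag])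
    have := i.2
    have := j.2
    omega
  have hm : 0 < es.length := by
    obtain ⟨e, he, -⟩ := hE.2.2 i j hij
    exact List.length_pos_of_mem he
  obtain ⟨s, t, hexec, ht, X, Z, y, ρ, hmax, hall, hρn, hZρ, hlag, hlab⟩ :=
    RealRAM.runs_gainProg hA hdiag hE hm hn
  have hn0 : (0 : ℝ) < n := by exact_mod_cast (by omega : 0 < n)
  have hy : ∀ i, y i = -1 ∨ y i = 1 ∨ y i = 0 := fun i => by
    rcases hlab i with h | h | h
    exacts [.inl h.1, .inr (.inl h.1), .inr (.inr h.1)]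
  obtain ⟨hvol, hquot⟩ := half_le_gainQuotient_of_lagrangian_le hA
    (lt_of_lt_of_le (by positivity) hρn) hZρ hy hlag
  refine ⟨s, t, hexec, ?_, Finset.univ.filter (y · = -1), Finset.univ.filter (y · = 1), ?_, ?_, ?_, ?_⟩
  · have hK := clog_le_three_mul_log hn
    calc (t : ℝ) ≤ ((12000 * (n * (n + es.length) * (Nat.clog 2 n * Nat.clog 2 n)) : ℕ) : ℝ) := by
          exact_mod_cast ht
      _ = 12000 * (n * (n + es.length)) * (Nat.clog 2 n * Nat.clog 2 n) := by push_cast; ring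
      _ ≤ 12000 * (n * (n + es.length)) * ((3 * Real.log n) * (3 * Real.log n)) := by gcongr
      _ = _ := by ring
  · rw [Finset.disjoint_filter]
    intro i _ h h'
    norm_num [h] at h'
  · intro i
    rcases hlab i with ⟨h, h'⟩ | ⟨h, h'⟩ | ⟨h, h'⟩ <;> norm_num [h, h']
  · rwa [volumeOf_filter hy]
  · rw [gain, cutVec_filter hy]
    refine le_trans ?_ hquot
    rcases lt_or_ge (ε * Nat.clog 2 n) 1 with hsmall | hlarge
    · exact exp_le_of_inv_le hε hε1 hn hsmall hρn
    obtain ⟨v, hv⟩ := exists_gainQuotient_powerStep_ge hA hε (natCast_lt_pow_clog hn hlarge) hgain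
    set L := ⌊8 / ε⌋₊ + 1 with hLdef
    have hLle : (L : ℝ) ≤ 8 / ε + 1 := by
      rw [hLdef, Nat.cast_add, Nat.cast_one]
      gcongr
      exact Nat.floor_le (by positivity)
    have hLlt : 8 / ε < L := by
      rw [hLdef, Nat.cast_add, Nat.cast_one]; exact Nat.lt_floor_add_one _
    have hL4 : 4 < ε / 2 * L := by
      rw [div_lt_iff₀ hε] at hLlt; linarith
    have hLK : L ≤ 9 * Nat.clog 2 n := by
      have h1 : 8 / ε ≤ 8 * Nat.clog 2 n := by
        rw [div_le_iff₀ hε]; linarith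
      have h2 : (1 : ℝ) ≤ Nat.clog 2 n := by exact_mod_cast Nat.clog_pos one_lt_two hn
      have h3 : (L : ℝ) ≤ 9 * Nat.clog 2 n := by linarith
      exact_mod_cast h3
    obtain ⟨w, r, hr, hwin⟩ := exists_window hA (by positivity) (hv.trans (hmax v)) hL4
    exact exp_le_of_div_two_pow_le hε hε1 hLle (hwin.trans (hall w L (by omega) hLK r hr))
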